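/- Let $F_2$ be the free group on $a,b$, let $L_2=\{a,b,a^{-1},b^{-1}\}$, and identify each element of $F_2$ with its reduced word over $L_2$; $|w|$ is the length of this word. Let $C_2$ be the set of cyclically reduced words, that is, reduced words $x_1\cdots x_n$ with $x_n\neq x_1^{-1}$. An automorphic conjugacy class is an orbit $W$ of $\operatorname{Aut}F_2$ on $F_2$; a word is minimal if its length is least in its class. For a nonempty word $u\in C_2$ of length $k$ and $w=x_1\cdots x_n\in C_2$, let $(u)_w$ be the total number of (possibly overlapping) occurrences of $u$ and $u^{-1}$ as contiguous subwords of $x_1\cdots x_nx_1\cdots x_{k-1}$ if $k\le n$, and $(u)_w=0$ if $k>n$. A word $w\in C_2$ is a root word if $|(ab)_w-(ab^{-1})_w|=(aa)_w=(bb)_w$, and it is alternating if $(aa)_w=0=(bb)_w$. A root class is an automorphic conjugacy class that contains a root word. A permutation is an automorphism of $F_2$ that permutes $L_2$. For $x,y\in L_2$ with $y\notin\{x,x^{-1}\}$, the one-letter automorphism $(\{y\},x)$ is the automorphism with $x\mapsto x$ and $y\mapsto yx$. Let $J\le\operatorname{Aut}F_2$ be the subgroup generated by the inner automorphisms and the permutations,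 and write $w\sim_J v$ if $\phi(w)=v$ for some $\phi\in J$. The directed multigraph $\Gamma(W)$ has as its vertices the $\sim_J$-classes $[w]$ of the minimal words $w\in W$, and it has one edge from $[w]$ to $[v]$ for each class $[\phi]$ modulo $\operatorname{Inn}F_2$ of one-letter automorphisms such that $\phi(w)\in[v]$ (the number of these edges does not depend on the representatives $w$, $v$). Theorem. Let $W$ be a root class that contains no alternating minimal word. Then $\Gamma(W)$ is isomorphic to one of the following directed multigraphs. (R1) One vertex with two loops. (R2) Two vertices $p$, $q$ with exactly two edges from $p$ to $q$, one edge from $q$ to $p$, one loop at $q$, and no loop at $p$. (R3) The bidirected 3-cycle: three vertices, exactly one edge from each vertex to each of the other two, and no loops. -/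

import Mathlib

namespace FreeGroupTwo

/-- The free group of rank two. -/
abbrev F2 : Type := FreeGroup (Fin 2)

/-- The first free generator. -/
def a : F2 := FreeGroup.of 0

/-- The second free generator. -/
def b : F2 := FreeGroup.of 1

/-- The four letters `a, b, a⁻¹, b⁻¹`. -/
def L2 : Set F2 := {a, b, a⁻¹, b⁻¹}

/-- The length of the reduced word representing `w`. -/
def len (w : F2) : ℕ := w.toWord.length

/-- `C2` is the set of reduced words `x₁ ⋯ xₙ` with `xₙ ≠ x₁⁻¹`. -/
def C2 : Set F2 := {w | FreeGroup.IsCyclicallyReduced w.toWord}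

/-- `W` is an automorphic conjugacy class: an orbit of `Aut F₂` on `F₂`. -/
def IsAutomorphicClass (W : Set F2) : Prop :=
  ∃ w : F2, W = {v | ∃ φ : MulAut F2, φ w = v}

/-- `w` has minimal length in its automorphic conjugacy class. -/
def IsMinimal (w : F2) : Prop := ∀ φ : MulAut F2, len w ≤ len (φ w)

/-- The number of (possibly overlapping) occurrences of the nonempty word `u` as a contiguous
subword of the word `l`. -/
def occurrences (u l : List (Fin 2 × Bool)) : ℕ := l.tails.countP (fun t => u.isPrefixOf t)

/-- `(u)_w`, for nonempty `u`: if `k = |u| ≤ |w| = n`, the total number of occurrences of `u` and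
of `u⁻¹` in `x₁ ⋯ xₙ x₁ ⋯ x₍ₖ₋₁₎`, where `w = x₁ ⋯ xₙ`; and `0` if `|u| > |w|`. -/
def subwordCount (u w : F2) : ℕ :=
  if len u ≤ len w then
    occurrences u.toWord (w.toWord ++ w.toWord.take (len u - 1)) +
      occurrences u⁻¹.toWord (w.toWord ++ w.toWord.take (len u - 1))
  else 0

/-- Root words: `|(ab)_w - (ab⁻¹)_w| = (aa)_w = (bb)_w`. -/
def IsRootWord (w : F2) : Prop :=
  w ∈ C2 ∧
    |(subwordCount (a * b) w : ℤ) - (subwordCount (a * b⁻¹) w : ℤ)| = subwordCount (a * a) w ∧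
    subwordCount (a * a) w = subwordCount (b * b) w

/-- Alternating words: `(aa)_w = 0 = (bb)_w`. -/
def IsAlternating (w : F2) : Prop :=
  w ∈ C2 ∧ subwordCount (a * a) w = 0 ∧ subwordCount (b * b) w = 0

/-- A root class is an automorphic conjugacy class containing a root word. -/
def IsRootClass (W : Set F2) : Prop := IsAutomorphicClass W ∧ ∃ w ∈ W, IsRootWord w

/-- A permutation (Type I automorphism) is an automorphism that permutes the letters. -/
def IsPermutation (π : MulAut F2) : Prop := π '' L2 = L2

open Classical in
/-- `φ` is the Type II automorphism `(A, x)`. -/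
def IsTypeII (A : Set F2) (x : F2) (φ : MulAut F2) : Prop :=
  x ∈ L2 ∧ A ⊆ L2 \ {x, x⁻¹} ∧
    ∀ y ∈ L2, φ y = (if y⁻¹ ∈ A then x⁻¹ else 1) * y * (if y ∈ A then x else 1)

/-- A one-letter automorphism is a Type II automorphism `({y}, x)`. -/
def IsOneLetter (φ : MulAut F2) : Prop := ∃ x y : F2, IsTypeII {y} x φ

/-- The normal subgroup of inner automorphisms. -/
def Inn : Subgroup (MulAut F2) := (MulAut.conj : F2 →* MulAut F2).range

instance : Inn.Normal where
  conj_mem := by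
    rintro _ ⟨g, rfl⟩ φ
    refine ⟨φ g, ?_⟩
    ext z
    simp

/-- The subgroup `J` generated by inner automorphisms and permutations. -/
def J : Subgroup (MulAut F2) := Subgroup.closure ((Inn : Set (MulAut F2)) ∪ {π | IsPermutation π})

/-- `w ∼_J v`. -/
def JRel (w v : F2) : Prop := ∃ φ ∈ J, φ w = v

theorem JRel.refl (w : F2) : JRel w w := ⟨1, J.one_mem, rfl⟩

theorem JRel.symm {w v : F2} (h : JRel w v) : JRel v w := by
  obtain ⟨φ, hφ, rfl⟩ := h
  exact ⟨φ⁻¹, J.inv_mem hφ, by simp⟩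

theorem JRel.trans {u v w : F2} (h : JRel u v) (h' : JRel v w) : JRel u w := by
  obtain ⟨φ, hφ, rfl⟩ := h
  obtain ⟨ψ, hψ, rfl⟩ := h'
  exact ⟨ψ * φ, J.mul_mem hψ hφ, rfl⟩

/-- The minimal words in `W`. -/
def MinimalWord (W : Set F2) : Type := {w : F2 // w ∈ W ∧ IsMinimal w}

/-- The relation `∼_J` on the minimal words in `W`. -/
def minimalSetoid (W : Set F2) : Setoid (MinimalWord W) where
  r w v := JRel w.1 v.1
  iseqv := ⟨fun w => JRel.refl w.1, JRel.symm, JRel.trans⟩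

/-- The classes `[φ]` modulo `Inn F₂` of one-letter automorphisms such that `[w]` is connected to
`[v]` by `[φ]`, that is, `φ(w) ∈ [v]`. -/
def connecting (w v : F2) : Set (MulAut F2 ⧸ Inn) :=
  {c | ∃ φ : MulAut F2, IsOneLetter φ ∧ (φ : MulAut F2 ⧸ Inn) = c ∧ JRel (φ w) v}

theorem IsPermutation.inv {π : MulAut F2} (h : IsPermutation π) : IsPermutation π⁻¹ := by
  unfold IsPermutation at h ⊢
  conv_lhs => rw [← h]
  rw [Set.image_image]
  simp

theorem IsPermutation.mem {π : MulAut F2} (h : IsPermutation π) {x : F2} (hx : x ∈ L2) :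
    π x ∈ L2 := by
  unfold IsPermutation at h
  rw [← h]
  exact ⟨x, hx, rfl⟩

theorem IsOneLetter.conj_permutation {π φ : MulAut F2} (hπ : IsPermutation π)
    (h : IsOneLetter φ) : IsOneLetter (π * φ * π⁻¹) := by
  obtain ⟨x, y, hx, hA, hφ⟩ := h
  have hy := hA rfl
  refine ⟨π x, π y, hπ.mem hx, ?_, fun z hz => ?_⟩
  · rintro _ rfl
    refine ⟨hπ.mem hy.1, ?_⟩
    have h2 := hy.2
    simp only [Set.mem_insert_iff, Set.mem_singleton_iff, ← map_inv, EmbeddingLike.apply_eq_iff_eq]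
      at h2 ⊢
    exact h2
  · obtain ⟨t, rfl⟩ := π.surjective z
    have ht : t ∈ L2 := by simpa using hπ.inv.mem hz
    have e : (π * φ * π⁻¹) (π t) = π (φ t) := by simp
    rw [e, hφ t ht]
    simp only [Set.mem_singleton_iff, ← map_inv, EmbeddingLike.apply_eq_iff_eq, map_mul]
    split_ifs <;> simp

theorem IsOneLetter.conj_J {j : MulAut F2} (hj : j ∈ J) :
    ∀ φ, IsOneLetter φ → ∃ φ', IsOneLetter φ' ∧
      (φ' : MulAut F2 ⧸ Inn) = (j : MulAut F2 ⧸ Inn) * φ * (j : MulAut F2 ⧸ Inn)⁻¹ := by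
  have gen : ∀ x : MulAut F2, x ∈ (Inn : Set (MulAut F2)) ∪ {π | IsPermutation π} →
      ∀ φ, IsOneLetter φ → ∃ φ', IsOneLetter φ' ∧
      (φ' : MulAut F2 ⧸ Inn) = (x : MulAut F2 ⧸ Inn) * φ * (x : MulAut F2 ⧸ Inn)⁻¹ := by
    rintro x (hx | hx) φ hφ
    · refine ⟨φ, hφ, ?_⟩
      rw [(QuotientGroup.eq_one_iff x).2 hx]
      simp
    · exact ⟨x * φ * x⁻¹, hφ.conj_permutation hx, rfl⟩
  have hj' : j ∈ Subgroup.closure ((Inn : Set (MulAut F2)) ∪ {π | IsPermutation π}) := hj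
  clear hj
  induction hj' using Subgroup.closure_induction'' with
  | mem x hx => exact gen x hx
  | inv_mem x hx =>
    rcases hx with hx | hx
    · exact gen x⁻¹ (Or.inl (Inn.inv_mem hx))
    · exact gen x⁻¹ (Or.inr (IsPermutation.inv hx))
  | one => exact fun φ hφ => ⟨φ, hφ, by simp⟩
  | mul x y _ _ hx hy =>
    intro φ hφ
    obtain ⟨φ₁, h₁, e₁⟩ := hy φ hφ
    obtain ⟨φ₂, h₂, e₂⟩ := hx φ₁ h₁
    refine ⟨φ₂, h₂, ?_⟩
    rw [e₂, e₁]
    simp [mul_assoc]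

theorem connecting_conj {j : MulAut F2} (hj : j ∈ J) {w v v' : F2} (hv : JRel v v')
    {c : MulAut F2 ⧸ Inn} (hc : c ∈ connecting w v) :
    (j : MulAut F2 ⧸ Inn) * c * (j : MulAut F2 ⧸ Inn)⁻¹ ∈ connecting (j w) v' := by
  obtain ⟨φ, hφ, rfl, hr⟩ := hc
  obtain ⟨φ', hφ', e⟩ := IsOneLetter.conj_J hj φ hφ
  refine ⟨φ', hφ', e, ?_⟩
  have e' : ((j * φ * j⁻¹ : MulAut F2) : MulAut F2 ⧸ Inn) = φ' := by rw [e]; rfl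
  have hm : (j * φ * j⁻¹)⁻¹ * φ' ∈ Inn := QuotientGroup.eq.1 e'
  have hm' : φ' * (j * φ * j⁻¹)⁻¹ ∈ Inn := by
    have := (inferInstance : Inn.Normal).conj_mem _ hm (j * φ * j⁻¹)
    simpa [mul_assoc] using this
  have h1 : JRel (φ w) (φ' (j w)) := by
    refine ⟨φ' * (j * φ * j⁻¹)⁻¹ * j,
      J.mul_mem (Subgroup.subset_closure (Or.inl hm')) hj, ?_⟩
    simp
  exact (h1.symm.trans hr).trans hv

theorem ncard_connecting_congr {w w' v v' : F2} (hw : JRel w w') (hv : JRel v v') :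
    (connecting w v).ncard = (connecting w' v').ncard := by
  obtain ⟨j, hj, rfl⟩ := hw
  have key : (fun c => (j : MulAut F2 ⧸ Inn) * c * (j : MulAut F2 ⧸ Inn)⁻¹) '' connecting w v =
      connecting (j w) v' := by
    apply Set.Subset.antisymm
    · rintro _ ⟨c, hc, rfl⟩
      exact connecting_conj hj hv hc
    · intro c hc
      refine ⟨(j : MulAut F2 ⧸ Inn)⁻¹ * c * j, ?_, by simp [mul_assoc]⟩
      have := connecting_conj (J.inv_mem hj) hv.symm hc
      simpa using this
  rw [← key, Set.ncard_image_of_injective]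
  intro c d h
  simpa using h

/-- A directed multigraph, loops and multiple edges allowed: `edges u v` is the number of edges
from `u` to `v`. -/
structure DirectedMultigraph where
  /-- the vertices -/
  V : Type
  /-- the number of edges from one vertex to another -/
  edges : V → V → ℕ

/-- Isomorphism of directed multigraphs. -/
def DirectedMultigraph.Isomorphic (G H : DirectedMultigraph) : Prop :=
  ∃ e : G.V ≃ H.V, ∀ u v : G.V, G.edges u v = H.edges (e u) (e v)

/-- The graph `Γ(W)`: its vertices are the classes `[w]` of minimal words in `W` modulo `∼_J`, and
there is one edge from `[w]` to `[v]` for each class `[φ]` modulo `Inn F₂` of one-letter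
automorphisms such that `[w]` is connected to `[v]` by `[φ]`. -/
noncomputable def Gam (W : Set F2) : DirectedMultigraph where
  V := Quotient (minimalSetoid W)
  edges := Quotient.lift₂ (fun w v => (connecting w.1 v.1).ncard)
    (fun _ _ _ _ hw hv => ncard_connecting_congr hw hv)

/-- (R1): one vertex with two loops. -/
def R1 : DirectedMultigraph where
  V := Fin 1
  edges := ![![2]]

/-- (R2): two edges from the first vertex to the second, one edge back, and one loop at the
second. -/
def R2 : DirectedMultigraph where
  V := Fin 2
  edges := ![![0, 2], ![1, 1]]

/-- (R3): the bidirected 3-cycle. -/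
def R3 : DirectedMultigraph where
  V := Fin 3
  edges := ![![0, 1, 1], ![1, 0, 1], ![1, 1, 0]]

end FreeGroupTwo

/-! ### Counting letters and adjacent pairs in reduced words -/

namespace FreeGroupTwo

open FreeGroup

/-! Modulo inner automorphisms there are four one-letter automorphisms: `posA`, `posB` and their
inverses. Counting cancellations in a cyclic word shows that they change its length by A + D, B + D,
A - D, B - D, where A = (aa), B = (bb) and D = (ab) - (ab⁻¹) (`exists_increments`). For a root word
|D| = A = B, so after possibly inverting b both `posA` and `posB` preserve the length. The resulting
words w, `posA w`, `posB w` form a triangle: up to `J`, its third side is again a single move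
(`exists_posB_inv_mul_posA`, `exists_posA_inv_mul_posB`).

The same triangle relations, together with Nielsen's theorem that the moves and `J` generate the
automorphism group (`elementaryAut_eq_top`), show that every automorphism is an element of `J` times
a product of moves of a single sign (`exists_J_mul_monotone`). Along such a product the length is
monotone once the sign of D is right: a positive move applied where D ≥ 0 does not shorten the word
and keeps D ≥ 0, with strict versions, and dually for negative moves (`drift_pos_step`,
`drift_neg_step`). In the triangle D ≤ 0 at w and D ≥ 0 at the other two vertices, so its words have
least cyclic length; if the three inequalities are strict, the triangle contains all minimal words
up to `J` (`triangle_minimal`).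

If D vanishes at a vertex, all four moves preserve the length there, which forces A = B = 0 and
yields an alternating minimal word. Hence the inequalities are strict in a class without such words,
and exactly two moves at each vertex preserve the length, leading to the other two vertices. The
graph is therefore the bidirected 3-cycle with some vertices possibly identified, and the three
patterns of identification give the three graphs (`DirectedMultigraph.isomorphic_of_triangle`). -/

/-- The inverse letter. -/
def bar (x : Fin 2 × Bool) : Fin 2 × Bool := (x.1, !x.2)

/-- The number of occurrences of the two-letter word `xy` and of its inverse in a list. -/
def pairCount (x y : Fin 2 × Bool) : List (Fin 2 × Bool) → ℕ
  | p :: q :: t => (if p = x ∧ q = y then 1 else 0) + (if p = bar y ∧ q = bar x then 1 else 0) +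
      pairCount x y (q :: t)
  | _ => 0

/-- The number of occurrences of a letter and of its inverse in a list. -/
def letterCount (x : Fin 2 × Bool) (l : List (Fin 2 × Bool)) : ℕ := l.count x + l.count (bar x)

theorem bar_bar (x : Fin 2 × Bool) : bar (bar x) = x := by simp [bar]

theorem occurrences_pair (x y : Fin 2 × Bool) (l : List (Fin 2 × Bool)) :
    occurrences [x, y] l + occurrences [bar y, bar x] l = pairCount x y l := by
  induction l with
  | nil => simp [occurrences, pairCount]
  | cons p t ih =>
    cases t with
    | nil => simp [occurrences, pairCount]
    | cons q t =>
      rw [pairCount, ← ih]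
      simp only [occurrences, List.tails_cons, List.countP_cons, List.isPrefixOf]
      simp only [Bool.and_true, Bool.and_eq_true, beq_iff_eq, eq_comm (a := x), eq_comm (a := y),
        eq_comm (a := bar x), eq_comm (a := bar y)]
      omega

/-- A pair straddling the seam is charged to the first factor, which therefore borrows one letter of
the second. -/
theorem pairCount_append (x y : Fin 2 × Bool) (l m : List (Fin 2 × Bool)) :
    pairCount x y (l ++ m) = pairCount x y (l ++ m.take 1) + pairCount x y m := by
  induction l with
  | nil => cases m <;> simp [pairCount]
  | cons p t ih =>
    cases t with
    | nil => cases m <;> simp [pairCount]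
    | cons q t =>
      simp only [List.cons_append, pairCount] at ih ⊢
      omega

/-- All copies but the last see the first letter of the next copy, so each contributes the cyclic
count. Powers thus turn linear counts into cyclic ones. -/
theorem pairCount_flatten_replicate (x y : Fin 2 × Bool) (l : List (Fin 2 × Bool)) (n : ℕ) :
    pairCount x y (List.replicate (n + 1) l).flatten =
      n * pairCount x y (l ++ l.take 1) + pairCount x y l := by
  rcases eq_or_ne l [] with rfl | hl
  · simp [pairCount]
  obtain ⟨p, t, rfl⟩ := List.exists_cons_of_ne_nil hl
  induction n with
  | zero => simp
  | succ n ih =>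
    rw [List.replicate_succ, List.flatten_cons, pairCount_append, ih]
    simp [List.replicate_succ]
    ring

theorem letterCount_append (x : Fin 2 × Bool) (l m : List (Fin 2 × Bool)) :
    letterCount x (l ++ m) = letterCount x l + letterCount x m := by
  simp [letterCount]; ring

theorem letterCount_flatten_replicate (x : Fin 2 × Bool) (l : List (Fin 2 × Bool)) (n : ℕ) :
    letterCount x (List.replicate n l).flatten = n * letterCount x l := by
  induction n with
  | zero => simp [letterCount]
  | succ n ih =>
    rw [List.replicate_succ, List.flatten_cons, letterCount_append, ih]
    ring

theorem pairCount_map {f : Fin 2 × Bool → Fin 2 × Bool} (hf : f.Injective)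
    (hb : ∀ x, f (bar x) = bar (f x)) (x y : Fin 2 × Bool) (l : List (Fin 2 × Bool)) :
    pairCount (f x) (f y) (l.map f) = pairCount x y l := by
  induction l with
  | nil => simp [pairCount]
  | cons p t ih =>
    cases t with
    | nil => simp [pairCount]
    | cons q t =>
      simp only [List.map_cons, pairCount, ← hb, hf.eq_iff] at ih ⊢
      rw [ih]

theorem pairCount_bar (x y : Fin 2 × Bool) (l : List (Fin 2 × Bool)) :
    pairCount (bar y) (bar x) l = pairCount x y l := by
  induction l with
  | nil => simp [pairCount]
  | cons p t ih =>
    cases t with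
    | nil => simp [pairCount]
    | cons q t =>
      simp only [pairCount, bar_bar, ih]
      ring

/-- Every letter `x` of a reduced word is followed by `x`, `y` or `y⁻¹`, and every letter `x⁻¹` is
preceded by the inverse of one of these, except at the ends of the word. -/
theorem letterCount_eq_pairCount {x y : Fin 2 × Bool} (hxy : x.1 ≠ y.1) (p : Fin 2 × Bool)
    (t : List (Fin 2 × Bool)) (h : IsReduced (p :: t)) :
    letterCount x (p :: t) = pairCount x x (p :: t) + pairCount x y (p :: t) +
      pairCount x (bar y) (p :: t) + (if p = bar x then 1 else 0) +
      (if (p :: t).getLast (by simp) = x then 1 else 0) := by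
  induction t generalizing p with
  | nil =>
    by_cases hp : p = x <;> simp [letterCount, pairCount, List.count_cons, hp, add_comm]
  | cons q t ih =>
    have ih' := ih q (h.tail)
    have hpq := (isReduced_cons_cons.1 h).1
    rw [List.getLast_cons (by simp), pairCount, pairCount, pairCount]
    have e : letterCount x (p :: q :: t) = letterCount x (q :: t) + (if p = x then 1 else 0) +
        (if p = bar x then 1 else 0) := by
      simp [letterCount, List.count_cons]; ring
    rw [e, ih']
    have key : (if p = x then 1 else 0) + (if q = bar x then 1 else 0) =
      (if p = x ∧ q = x then 1 else 0) + (if p = bar x ∧ q = bar x then 1 else 0) +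
      ((if p = x ∧ q = y then 1 else 0) + (if p = bar y ∧ q = bar x then 1 else 0)) +
      ((if p = x ∧ q = bar y then 1 else 0) + (if p = bar (bar y) ∧ q = bar x then 1 else 0)) := by
      clear ih ih' e h
      revert hpq hxy
      revert p q x y
      decide
    omega

/-- Cyclic version of `letterCount_eq_pairCount`. -/
theorem letterCount_eq_cyclic {x y : Fin 2 × Bool} (hxy : x.1 ≠ y.1) {l : List (Fin 2 × Bool)}
    (h : IsCyclicallyReduced l) :
    letterCount x l = pairCount x x (l ++ l.take 1) + pairCount x y (l ++ l.take 1) +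
      pairCount x (bar y) (l ++ l.take 1) := by
  cases l with
  | nil => simp [letterCount, pairCount]
  | cons p t =>
    -- The word closed up by its first letter is a subword of its square, hence reduced. The two end
    -- corrections then cancel the contribution of the extra letter.
    have hr : IsReduced (p :: (t ++ [p])) := by
      have := h.flatten_replicate 2
      refine this.isReduced.infix ⟨[], t, ?_⟩
      simp [List.replicate_succ]
    have := letterCount_eq_pairCount hxy p (t ++ [p]) hr
    have e : letterCount x (p :: (t ++ [p])) = letterCount x (p :: t) +
        ((if p = bar x then 1 else 0) + (if p = x then 1 else 0)) := by
      rw [← List.cons_append, letterCount_append]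
      simp [letterCount, List.count_cons, add_comm]
    have hl : (p :: (t ++ [p])).getLast (by simp) = p := by simp
    rw [e, hl] at this
    simp only [List.take_succ_cons, List.take_zero, List.cons_append] at this ⊢
    omega

/-- Letter counts do not distinguish a letter from its inverse. Comparing the cyclic identities for
x and x⁻¹ gives (xy) - (yx) = (x⁻¹y) - (xy⁻¹); those for y and y⁻¹ give the same with the opposite
sign on the right. -/
theorem pairCount_cyclic_comm {x y : Fin 2 × Bool} (hxy : x.1 ≠ y.1) {l : List (Fin 2 × Bool)}
    (h : IsCyclicallyReduced l) :
    pairCount x y (l ++ l.take 1) = pairCount y x (l ++ l.take 1) := by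
  have h1 := letterCount_eq_cyclic hxy h
  have h2 := letterCount_eq_cyclic (x := bar x) (y := bar y) hxy h
  have h3 := letterCount_eq_cyclic hxy.symm h
  have h4 := letterCount_eq_cyclic (x := bar y) (y := bar x) hxy.symm h
  have e : ∀ z, letterCount (bar z) l = letterCount z l := fun z => by
    simp [letterCount, bar_bar]; ring
  have s1 := pairCount_bar x (bar y) (l ++ l.take 1)
  have s2 := pairCount_bar (bar x) y (l ++ l.take 1)
  simp only [bar_bar, e, pairCount_bar] at h1 h2 h3 h4 s1 s2
  omega

end FreeGroupTwo

/-! ### The length of a word under the substitution a ↦ ab -/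

namespace FreeGroupTwo

open FreeGroup (mk lift mul_mk one_eq_mk IsCyclicallyReduced isReduced_cons_cons isReduced_toWord)

theorem pairCount_cons (x y p : Fin 2 × Bool) (t : List (Fin 2 × Bool)) :
    pairCount x y (p :: t) = (if p = x ∧ t.head? = some y then 1 else 0) +
      (if p = bar y ∧ t.head? = some (bar x) then 1 else 0) + pairCount x y t := by
  cases t <;> simp [pairCount]

theorem letterCount_cons (x p : Fin 2 × Bool) (t : List (Fin 2 × Bool)) :
    letterCount x (p :: t) =
      (if p = x then 1 else 0) + (if p = bar x then 1 else 0) + letterCount x t := by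
  simp [letterCount, List.count_cons]; ring

/-- The image of a word under the substitution `a ↦ ab`, reduced when the word is. -/
def substWord : List (Fin 2 × Bool) → List (Fin 2 × Bool)
  | (0, true) :: (1, false) :: t => (0, true) :: substWord t
  | (0, true) :: t => (0, true) :: (1, true) :: substWord t
  | (1, true) :: (0, false) :: t => (0, false) :: substWord t
  | (1, true) :: t => (1, true) :: substWord t
  | (0, false) :: t => (1, false) :: (0, false) :: substWord t
  | (1, false) :: t => (1, false) :: substWord t
  | [] => []

/-- The automorphism `({a}, b)`: `a ↦ ab`, `b ↦ b`. -/
def posA : MulAut F2 :=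
  MonoidHom.toMulEquiv (lift ![a * b, b]) (lift ![a * b⁻¹, b])
    (by ext i; fin_cases i <;> simp [a, b]) (by ext i; fin_cases i <;> simp [a, b])

@[simp] theorem posA_a : posA a = a * b := by simp [posA, a]

@[simp] theorem posA_b : posA b = b := by simp [posA, b]

theorem mk_zero_true : mk [(0, true)] = a := rfl
theorem mk_one_true : mk [(1, true)] = b := rfl
theorem mk_zero_false : mk [(0, false)] = a⁻¹ := rfl
theorem mk_one_false : mk [(1, false)] = b⁻¹ := rfl

theorem mk_cons_eq (p : Fin 2 × Bool) (t : List (Fin 2 × Bool)) :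
    (mk (p :: t) : F2) = mk [p] * mk t := by rw [mul_mk]; rfl

theorem mk_substWord (l : List (Fin 2 × Bool)) : mk (substWord l) = posA (mk l) := by
  fun_induction substWord l with
  | case7 => simp [← one_eq_mk]
  | case1 t ih | case2 t _ ih | case3 t ih | case4 t _ ih | case5 t ih | case6 t ih =>
    simp only [mk_cons_eq _ (_ :: _), mk_cons_eq _ (substWord _), mk_cons_eq _ t, map_mul, ih,
      mk_zero_true, mk_one_true, mk_zero_false, mk_one_false, posA_a, posA_b, map_inv,
      mul_inv_rev, mul_assoc, mul_inv_cancel_left]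

theorem head?_cases (t : List (Fin 2 × Bool)) : t = [] ∨ t.head? = some (0, true) ∨
    t.head? = some (0, false) ∨ t.head? = some (1, true) ∨ t.head? = some (1, false) := by
  rcases t with - | ⟨⟨i, s⟩, t⟩
  · simp
  · fin_cases i <;> cases s <;> simp

theorem head?_ne_of_forall_ne_cons {p : Fin 2 × Bool} {t : List (Fin 2 × Bool)}
    (h : ∀ t', t = p :: t' → False) : t.head? ≠ some p := by
  rcases t with - | ⟨q, t⟩
  · simp
  · rintro ⟨⟩; exact h t rfl

/-- The clauses on first letters strengthen the induction: they decide whether the letters put in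
front can cancel. -/
theorem isReduced_substWord (l : List (Fin 2 × Bool)) (h : FreeGroup.IsReduced l) :
    FreeGroup.IsReduced (substWord l) ∧
      ((l.head? = some (0, true) → (substWord l).head? = some (0, true)) ∧
        (l.head? = some (1, true) → (substWord l).head? = some (1, true) ∨
          (substWord l).head? = some (0, false)) ∧
        (l.head? = some (0, false) → (substWord l).head? = some (1, false)) ∧
        (l.head? = some (1, false) → (substWord l).head? = some (1, false))) ∧
      (l = [] → substWord l = []) := by
  unfold FreeGroup.IsReduced at *
  fun_induction substWord l with
  | case7 => simp
  | case1 t ih | case3 t ih | case5 t ih | case6 t ih =>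
    simp only [List.isChain_cons] at h
    obtain ⟨hr, ⟨h1, h2, h3, h4⟩, h5⟩ := ih (by tauto)
    clear ih
    rcases head?_cases t with h' | h' | h' | h' | h'
    · subst h'
      simp [h5]
    · have hs := h1 h'
      clear h1 h2 h3 h4 h5
      first | (exfalso; simp [h'] at h; done) | simp [List.isChain_cons, hs, hr]
    · have hs := h3 h'
      clear h1 h2 h3 h4 h5
      first | (exfalso; simp [h'] at h; done) | simp [List.isChain_cons, hs, hr]
    · rcases h2 h' with hs | hs
      all_goals
        clear h1 h2 h3 h4 h5
        first | (exfalso; simp [h'] at h; done) | simp [List.isChain_cons, hs, hr]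
    · have hs := h4 h'
      clear h1 h2 h3 h4 h5
      first | (exfalso; simp [h'] at h; done) | simp [List.isChain_cons, hs, hr]
  | case2 t ht ih | case4 t ht ih =>
    simp only [List.isChain_cons] at h
    obtain ⟨hr, ⟨h1, h2, h3, h4⟩, h5⟩ := ih (by tauto)
    have ht' := head?_ne_of_forall_ne_cons ht
    clear ih ht
    rcases head?_cases t with h' | h' | h' | h' | h'
    · subst h'
      simp [h5]
    · have hs := h1 h'
      clear h1 h2 h3 h4 h5
      simp [List.isChain_cons, hs, hr]
    · have hs := h3 h'
      clear h1 h2 h3 h4 h5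
      first | (exfalso; simp [h'] at h; done) | exact absurd h' ht'
    · rcases h2 h' with hs | hs
      all_goals
        clear h1 h2 h3 h4 h5
        simp [List.isChain_cons, hs, hr]
    · have hs := h4 h'
      clear h1 h2 h3 h4 h5
      first | (exfalso; simp [h'] at h; done) | exact absurd h' ht'

/-- Each letter a or a⁻¹ brings in one new letter, and each occurrence of ab⁻¹ or its inverse
cancels two. -/
theorem length_substWord (l : List (Fin 2 × Bool)) :
    (substWord l).length + 2 * pairCount (0, true) (1, false) l =
      l.length + letterCount (0, true) l := by
  fun_induction substWord l with
  | case7 => simp [pairCount, letterCount]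
  | case2 t ht ih =>
    have := head?_ne_of_forall_ne_cons ht
    simp [pairCount_cons, letterCount_cons, bar, this]
    omega
  | case4 t ht ih =>
    have := head?_ne_of_forall_ne_cons ht
    simp [pairCount_cons, letterCount_cons, bar, this]
    omega
  | case1 t ih | case3 t ih | case5 t ih | case6 t ih =>
    simp [pairCount_cons, letterCount_cons, bar]
    omega

theorem len_posA (w : F2) : len (posA w) + 2 * pairCount (0, true) (1, false) w.toWord =
    len w + letterCount (0, true) w.toWord := by
  have h : (posA w).toWord = substWord w.toWord := by
    rw [← (isReduced_substWord _ isReduced_toWord).1.reduce_eq, ← FreeGroup.toWord_mk,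
      mk_substWord, FreeGroup.mk_toWord]
  rw [len, len, h, length_substWord]

/-! ### Cyclic length as the growth rate of the lengths of powers -/

/-- The length of a cyclic reduction of `w`. -/
def cyclicLen (w : F2) : ℕ := (FreeGroup.reduceCyclically w.toWord).length

theorem len_pow (w : F2) (n : ℕ) : len (w ^ (n + 1)) =
    (n + 1) * cyclicLen w + 2 * (FreeGroup.reduceCyclically.conjugator w.toWord).length := by
  rw [len, FreeGroup.toWord_pow,
    FreeGroup.reduceCyclically.reduce_flatten_replicate_succ isReduced_toWord]
  simp [cyclicLen]
  ring

theorem eq_of_forall_mul_le {x y c : ℕ} (h : ∀ n : ℕ, n * x ≤ n * y + c) : x ≤ y := by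
  by_contra! hlt
  have := h (c + 1)
  nlinarith

/-- By `len_pow` the cyclic length is the slope of the length of powers, so a bounded error is
harmless. -/
theorem cyclicLen_le {w v : F2} (c : ℕ) (h : ∀ n, len (w ^ (n + 1)) ≤ len (v ^ (n + 1)) + c) :
    cyclicLen w ≤ cyclicLen v := by
  refine eq_of_forall_mul_le
    (c := cyclicLen v + 2 * (FreeGroup.reduceCyclically.conjugator v.toWord).length + c) fun n => ?_
  have := h n
  rw [len_pow, len_pow] at this
  nlinarith

theorem len_mul_le (u v : F2) : len (u * v) ≤ len u + len v := FreeGroup.norm_mul_le u v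

theorem len_inv (u : F2) : len u⁻¹ = len u := FreeGroup.norm_inv_eq

theorem cyclicLen_conj (g w : F2) : cyclicLen (g * w * g⁻¹) = cyclicLen w := by
  have key : ∀ g w : F2, cyclicLen (g * w * g⁻¹) ≤ cyclicLen w := fun g w => by
    refine cyclicLen_le (2 * len g) fun n => ?_
    rw [conj_pow]
    have h1 := len_mul_le (g * w ^ (n + 1)) g⁻¹
    have h2 := len_mul_le g (w ^ (n + 1))
    rw [len_inv] at h1
    omega
  refine le_antisymm (key g w) ?_
  simpa [mul_assoc] using key g⁻¹ (g * w * g⁻¹)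

theorem cyclicLen_le_len (w : F2) : cyclicLen w ≤ len w := by
  have h := congrArg List.length
    (FreeGroup.reduceCyclically.conj_conjugator_reduceCyclically w.toWord)
  simp only [List.length_append] at h
  rw [cyclicLen, len]
  omega

theorem exists_conj_mem_C2 (w : F2) : ∃ g : F2, g * w * g⁻¹ ∈ C2 ∧
    len (g * w * g⁻¹) = cyclicLen w := by
  have h := congrArg mk (FreeGroup.reduceCyclically.conj_conjugator_reduceCyclically w.toWord)
  have hr : FreeGroup.IsCyclicallyReduced (FreeGroup.reduceCyclically w.toWord) :=
    FreeGroup.reduceCyclically.isCyclicallyReduced isReduced_toWord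
  rw [← mul_mk, ← mul_mk, ← FreeGroup.inv_mk, FreeGroup.mk_toWord] at h
  refine ⟨(mk (FreeGroup.reduceCyclically.conjugator w.toWord))⁻¹, ?_⟩
  have e : (mk (FreeGroup.reduceCyclically.conjugator w.toWord))⁻¹ * w *
      (mk (FreeGroup.reduceCyclically.conjugator w.toWord))⁻¹⁻¹ =
      mk (FreeGroup.reduceCyclically w.toWord) := by
    nth_rw 2 [← h]
    group
  rw [e]
  simp only [C2, len, Set.mem_ofPred_eq, FreeGroup.toWord_mk, hr.isReduced.reduce_eq]
  exact ⟨hr, rfl⟩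

theorem toWord_pow_of_mem_C2 {w : F2} (hw : w ∈ C2) (n : ℕ) :
    (w ^ n).toWord = (List.replicate n w.toWord).flatten := by
  rw [FreeGroup.toWord_pow, (IsCyclicallyReduced.flatten_replicate hw n).isReduced.reduce_eq]

theorem cyclicLen_of_mem_C2 {w : F2} (hw : w ∈ C2) : cyclicLen w = len w := by
  refine le_antisymm (cyclicLen_le_len w) ?_
  refine eq_of_forall_mul_le
    (c := cyclicLen w + 2 * (FreeGroup.reduceCyclically.conjugator w.toWord).length) fun n => ?_
  have h := len_pow w n
  rw [len, toWord_pow_of_mem_C2 hw] at h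
  simp only [List.length_flatten, List.map_replicate, List.sum_replicate, smul_eq_mul] at h
  rw [len]
  nlinarith

theorem cyclicLen_posA {w : F2} (hw : w ∈ C2) :
    cyclicLen (posA w) +
      2 * pairCount (0, true) (1, false) (w.toWord ++ w.toWord.take 1) =
      len w + letterCount (0, true) w.toWord := by
  have h : ∀ n, len (posA w ^ (n + 1)) +
      2 * (n * pairCount (0, true) (1, false) (w.toWord ++ w.toWord.take 1) +
        pairCount (0, true) (1, false) w.toWord) =
      (n + 1) * len w + (n + 1) * letterCount (0, true) w.toWord := fun n => by
    rw [← map_pow]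
    have := len_posA (w ^ (n + 1))
    rw [← letterCount_flatten_replicate, ← pairCount_flatten_replicate,
      ← toWord_pow_of_mem_C2 hw, this, len, toWord_pow_of_mem_C2 hw]
    simp [len]
  simp only [len_pow] at h
  -- Both sides are affine in the exponent. Subtracting the values at 0 and 1 isolates the slopes
  -- and removes the conjugator.
  have h0 := h 0
  have h1 := h 1
  simp at h0 h1
  linarith

end FreeGroupTwo

/-! ### Permutations, and the length change under the four moves -/

namespace FreeGroupTwo

open FreeGroup (mk lift mul_mk one_eq_mk IsCyclicallyReduced isReduced_toWord)

/-- The number of cyclic occurrences of the two-letter word `xy` and of its inverse in `w`. -/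
def cyclicCount (x y : Fin 2 × Bool) (w : F2) : ℕ :=
  pairCount x y (w.toWord ++ w.toWord.take 1)

theorem subwordCount_eq_cyclicCount {u w : F2} {x y : Fin 2 × Bool} (hu : u.toWord = [x, y])
    (hw : 2 ≤ len w) : subwordCount u w = cyclicCount x y w := by
  have hi : u⁻¹.toWord = [bar y, bar x] := by
    rw [FreeGroup.toWord_inv, hu]; rfl
  have hl : len u = 2 := by rw [len, hu]; rfl
  rw [subwordCount, if_pos (hl ▸ hw), hl, hu, hi, occurrences_pair]
  rfl

theorem toWord_aa : (a * a).toWord = [(0, true), (0, true)] := by decide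
theorem toWord_bb : (b * b).toWord = [(1, true), (1, true)] := by decide
theorem toWord_ab : (a * b).toWord = [(0, true), (1, true)] := by decide
theorem toWord_ab_inv : (a * b⁻¹).toWord = [(0, true), (1, false)] := by decide

theorem subwordCount_of_len_lt {u w : F2} (h : len w < len u) : subwordCount u w = 0 :=
  if_neg (not_le.2 h)

/-- The automorphism `({b}, a)`: `a ↦ a`, `b ↦ ba`. -/
def posB : MulAut F2 :=
  MonoidHom.toMulEquiv (lift ![a, b * a]) (lift ![a, b * a⁻¹])
    (by ext i; fin_cases i <;> simp [a, b]) (by ext i; fin_cases i <;> simp [a, b])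

@[simp] theorem posB_a : posB a = a := by simp [posB, a]

@[simp] theorem posB_b : posB b = b * a := by simp [posB, b]

/-- The permutation exchanging `a` and `b`. -/
def swapAB : MulAut F2 :=
  MonoidHom.toMulEquiv (lift ![b, a]) (lift ![b, a])
    (by ext i; fin_cases i <;> simp [a, b]) (by ext i; fin_cases i <;> simp [a, b])

@[simp] theorem swapAB_a : swapAB a = b := by simp [swapAB, a]

@[simp] theorem swapAB_b : swapAB b = a := by simp [swapAB, b]

/-- The permutation inverting `b`. -/
def negB : MulAut F2 :=
  MonoidHom.toMulEquiv (lift ![a, b⁻¹]) (lift ![a, b⁻¹])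
    (by ext i; fin_cases i <;> simp [a, b]) (by ext i; fin_cases i <;> simp [a, b])

@[simp] theorem negB_a : negB a = a := by simp [negB, a]

@[simp] theorem negB_b : negB b = b⁻¹ := by simp [negB, b]

theorem aut_ext {φ ψ : MulAut F2} (ha : φ a = ψ a) (hb : φ b = ψ b) : φ = ψ := by
  have : φ.toMonoidHom = ψ.toMonoidHom := by
    ext i
    fin_cases i
    · exact ha
    · exact hb
  exact MulEquiv.ext fun x => DFunLike.congr_fun this x

@[simp] theorem posA_inv_a : posA⁻¹ a = a * b⁻¹ := by
  rw [MulAut.inv_apply, MulEquiv.symm_apply_eq]; simp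

@[simp] theorem posA_inv_b : posA⁻¹ b = b := by
  rw [MulAut.inv_apply, MulEquiv.symm_apply_eq]; simp

@[simp] theorem posB_inv_a : posB⁻¹ a = a := by
  rw [MulAut.inv_apply, MulEquiv.symm_apply_eq]; simp

@[simp] theorem posB_inv_b : posB⁻¹ b = b * a⁻¹ := by
  rw [MulAut.inv_apply, MulEquiv.symm_apply_eq]; simp

/-- The other three moves are conjugates of `posA` by permutations, which preserve length, so
cancellation is counted only once. -/
theorem posB_eq : posB = swapAB * posA * swapAB := by apply aut_ext <;> simp

theorem posA_inv_eq : posA⁻¹ = negB * posA * negB := by apply aut_ext <;> simp [-MulAut.inv_apply]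

theorem posB_inv_eq : posB⁻¹ = swapAB * negB * posA * (negB * swapAB) := by
  apply aut_ext <;> simp [-MulAut.inv_apply]

theorem toWord_mem_L2 {x : F2} (hx : x ∈ L2) : ∃ p, x = mk [p] := by
  rcases hx with rfl | rfl | rfl | rfl
  exacts [⟨(0, true), rfl⟩, ⟨(1, true), rfl⟩, ⟨(0, false), rfl⟩, ⟨(1, false), rfl⟩]

theorem mk_singleton_mem_L2 (p : Fin 2 × Bool) : mk [p] ∈ L2 := by
  obtain ⟨i, s⟩ := p
  fin_cases i <;> cases s
  · exact Or.inr (Or.inr (Or.inl rfl))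
  · exact Or.inl rfl
  · exact Or.inr (Or.inr (Or.inr rfl))
  · exact Or.inr (Or.inl rfl)

theorem IsPermutation.len_le {π : MulAut F2} (hπ : IsPermutation π) (w : F2) :
    len (π w) ≤ len w := by
  have key : ∀ l : List (Fin 2 × Bool), len (π (mk l)) ≤ l.length := fun l => by
    induction l with
    | nil => simp [← one_eq_mk, len]
    | cons p t ih =>
      rw [mk_cons_eq, map_mul]
      obtain ⟨q, hq⟩ := toWord_mem_L2 (hπ.mem (mk_singleton_mem_L2 p))
      have h1 := len_mul_le (π (mk [p])) (π (mk t))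
      have h2 : len (π (mk [p])) ≤ 1 := by
        rw [hq]; exact FreeGroup.norm_mk_le
      rw [List.length_cons]
      omega
  simpa [len, FreeGroup.mk_toWord] using key w.toWord

theorem IsPermutation.len_eq {π : MulAut F2} (hπ : IsPermutation π) (w : F2) :
    len (π w) = len w := by
  refine le_antisymm (hπ.len_le w) ?_
  simpa using hπ.inv.len_le (π w)

theorem IsPermutation.cyclicLen_eq {π : MulAut F2} (hπ : IsPermutation π) (w : F2) :
    cyclicLen (π w) = cyclicLen w := by
  apply le_antisymm <;>
  · refine cyclicLen_le 0 fun n => ?_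
    rw [← map_pow, hπ.len_eq]
    rfl

theorem cyclicLen_of_mem_J {j : MulAut F2} (hj : j ∈ J) :
    ∀ w, cyclicLen (j w) = cyclicLen w := by
  induction hj using Subgroup.closure_induction with
  | mem x hx =>
    rcases hx with ⟨g, rfl⟩ | hx
    · exact cyclicLen_conj g
    · exact hx.cyclicLen_eq
  | one => exact fun _ => rfl
  | mul x y _ _ hx hy => exact fun w => by rw [MulAut.mul_apply, hx, hy]
  | inv x _ hx => exact fun w => by rw [← hx]; simp

theorem isPermutation_swapAB : IsPermutation swapAB := by
  simp only [IsPermutation, L2, Set.image_insert_eq, Set.image_singleton, map_inv, swapAB_a,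
    swapAB_b]
  ext x; simp; tauto

theorem isPermutation_negB : IsPermutation negB := by
  simp only [IsPermutation, L2, Set.image_insert_eq, Set.image_singleton, map_inv, negB_a,
    negB_b, inv_inv]
  ext x; simp; tauto

theorem IsPermutation.mem_J {π : MulAut F2} (h : IsPermutation π) : π ∈ J :=
  Subgroup.subset_closure (Or.inr h)

theorem Inn_le_J : Inn ≤ J := fun _ h => Subgroup.subset_closure (Or.inl h)

theorem isReduced_map {f : Fin 2 × Bool → Fin 2 × Bool} (hf : f.Injective)
    (hb : ∀ x, f (bar x) = bar (f x)) {l : List (Fin 2 × Bool)} (h : FreeGroup.IsReduced l) :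
    FreeGroup.IsReduced (l.map f) := by
  have e : ∀ p q : Fin 2 × Bool, (p.1 = q.1 → p.2 = q.2) ↔ q ≠ bar p := by decide
  simp only [FreeGroup.IsReduced, List.isChain_map, e, ← hb, ne_eq, hf.eq_iff] at h ⊢
  exact h

theorem toWord_letterMap {f : Fin 2 × Bool → Fin 2 × Bool} (hf : f.Injective)
    (hb : ∀ x, f (bar x) = bar (f x)) {π : MulAut F2} (hπ : ∀ x, π (mk [x]) = mk [f x]) (w : F2) :
    (π w).toWord = w.toWord.map f := by
  have key : ∀ l : List (Fin 2 × Bool), π (mk l) = mk (l.map f) := fun l => by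
    induction l with
    | nil => simp [← one_eq_mk]
    | cons p t ih => rw [mk_cons_eq, map_mul, ih, hπ, List.map_cons, mk_cons_eq (f p) (t.map f)]
  rw [← (isReduced_map hf hb isReduced_toWord).reduce_eq, ← FreeGroup.toWord_mk, ← key,
    FreeGroup.mk_toWord]

theorem IsPermutation.exists_letterMap {π : MulAut F2} (hπ : IsPermutation π) :
    ∃ f : Fin 2 × Bool → Fin 2 × Bool, f.Injective ∧ (∀ x, f (bar x) = bar (f x)) ∧
      ∀ x, π (mk [x]) = mk [f x] := by
  choose f hf using fun x => toWord_mem_L2 (hπ.mem (mk_singleton_mem_L2 x))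
  have inj : ∀ p q : Fin 2 × Bool, (mk [p] : F2) = mk [q] → p = q := fun p q h => by
    simpa [FreeGroup.toWord_mk] using congrArg FreeGroup.toWord h
  have hbar : ∀ p : Fin 2 × Bool, (mk [bar p] : F2) = (mk [p])⁻¹ := fun p => by
    rw [FreeGroup.inv_mk]; rfl
  refine ⟨f, fun p q h => ?_, fun p => ?_, hf⟩
  · apply inj
    apply π.injective
    rw [hf, hf, h]
  · apply inj
    rw [← hf, hbar, map_inv, hf, hbar]

theorem IsPermutation.mem_C2 {π : MulAut F2} (hπ : IsPermutation π) {w : F2} (hw : w ∈ C2) :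
    π w ∈ C2 := by
  obtain ⟨f, hf, hb, h⟩ := hπ.exists_letterMap
  have e : ∀ p q : Fin 2 × Bool, (p.1 = q.1 → p.2 = q.2) ↔ q ≠ bar p := by decide
  simp only [C2, Set.mem_ofPred_eq, FreeGroup.isCyclicallyReduced_iff, e] at hw ⊢
  refine ⟨isReduced_toWord, ?_⟩
  rw [toWord_letterMap hf hb h]
  simp only [List.getLast?_map, List.head?_map, Option.mem_def, Option.map_eq_some_iff]
  rintro _ ⟨p, hp, rfl⟩ _ ⟨q, hq, rfl⟩
  rw [← hb, hf.ne_iff]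
  exact hw.2 p hp q hq

theorem cyclicCount_letterMap {f : Fin 2 × Bool → Fin 2 × Bool} (hf : f.Injective)
    (hb : ∀ x, f (bar x) = bar (f x)) {π : MulAut F2} (hπ : ∀ x, π (mk [x]) = mk [f x])
    (x y : Fin 2 × Bool) (w : F2) : cyclicCount (f x) (f y) (π w) = cyclicCount x y w := by
  rw [cyclicCount, toWord_letterMap hf hb hπ, ← List.map_take, ← List.map_append,
    pairCount_map hf hb]
  rfl

theorem cyclicCount_swapAB (x y : Fin 2 × Bool) (w : F2) :
    cyclicCount (1 - x.1, x.2) (1 - y.1, y.2) (swapAB w) = cyclicCount x y w := by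
  refine cyclicCount_letterMap (f := fun x => (1 - x.1, x.2)) (by decide) (by decide) ?_ x y w
  rintro ⟨i, s⟩
  fin_cases i <;> cases s
  · change swapAB a⁻¹ = b⁻¹; simp
  · exact swapAB_a
  · change swapAB b⁻¹ = a⁻¹; simp
  · exact swapAB_b

theorem cyclicCount_negB (x y : Fin 2 × Bool) (w : F2) :
    cyclicCount (x.1, if x.1 = 1 then !x.2 else x.2) (y.1, if y.1 = 1 then !y.2 else y.2)
      (negB w) = cyclicCount x y w := by
  refine cyclicCount_letterMap (f := fun x => (x.1, if x.1 = 1 then !x.2 else x.2)) (by decide)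
    (by decide) ?_ x y w
  rintro ⟨i, s⟩
  fin_cases i <;> cases s
  · change negB a⁻¹ = a⁻¹; simp
  · exact negB_a
  · change negB b⁻¹ = b; simp
  · exact negB_b

/-- The number of letters a^±1 is (aa) + (ab) + (ab⁻¹); subtracting 2(ab⁻¹) for the cancellations
leaves this increment. -/
theorem cyclicLen_posA_eq {w : F2} (hw : w ∈ C2) :
    (cyclicLen (posA w) : ℤ) = len w + cyclicCount (0, true) (0, true) w +
      cyclicCount (0, true) (1, true) w - cyclicCount (0, true) (1, false) w := by
  have h1 := cyclicLen_posA hw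
  have h2 := letterCount_eq_cyclic (x := (0, true)) (y := (1, true)) (by decide) hw
  simp only [cyclicCount]
  rw [h2] at h1
  simp only [bar, Bool.not_true] at h1
  omega

theorem cyclicLen_posA_inv_eq {w : F2} (hw : w ∈ C2) :
    (cyclicLen (posA⁻¹ w) : ℤ) = len w + cyclicCount (0, true) (0, true) w +
      cyclicCount (0, true) (1, false) w - cyclicCount (0, true) (1, true) w := by
  rw [posA_inv_eq, MulAut.mul_apply, MulAut.mul_apply, isPermutation_negB.cyclicLen_eq,
    cyclicLen_posA_eq (isPermutation_negB.mem_C2 hw), isPermutation_negB.len_eq,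
    ← cyclicCount_negB (0, true) (0, true) w, ← cyclicCount_negB (0, true) (1, false) w,
    ← cyclicCount_negB (0, true) (1, true) w]
  rfl

/-- Exchanging the generators would produce (ba) in place of (ab); these agree cyclically, so the
same difference (ab) - (ab⁻¹) governs both moves. -/
theorem cyclicLen_posB_eq {w : F2} (hw : w ∈ C2) :
    (cyclicLen (posB w) : ℤ) = len w + cyclicCount (1, true) (1, true) w +
      cyclicCount (0, true) (1, true) w - cyclicCount (0, true) (1, false) w := by
  have h1 : cyclicCount (0, true) (1, true) w = cyclicCount (1, true) (0, true) w :=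
    pairCount_cyclic_comm (by decide) hw
  have h2 : cyclicCount (0, true) (1, false) w = cyclicCount (1, true) (0, false) w :=
    (pairCount_bar _ _ _).symm
  rw [h1, h2, posB_eq, MulAut.mul_apply, MulAut.mul_apply, isPermutation_swapAB.cyclicLen_eq,
    cyclicLen_posA_eq (isPermutation_swapAB.mem_C2 hw), isPermutation_swapAB.len_eq,
    ← cyclicCount_swapAB (1, true) (1, true) w, ← cyclicCount_swapAB (1, true) (0, false) w,
    ← cyclicCount_swapAB (1, true) (0, true) w]
  rfl

theorem cyclicLen_posB_inv_eq {w : F2} (hw : w ∈ C2) :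
    (cyclicLen (posB⁻¹ w) : ℤ) = len w + cyclicCount (1, true) (1, true) w +
      cyclicCount (0, true) (1, false) w - cyclicCount (0, true) (1, true) w := by
  have h1 : cyclicCount (0, true) (1, true) w = cyclicCount (1, true) (0, true) w :=
    pairCount_cyclic_comm (by decide) hw
  have h2 : cyclicCount (0, true) (1, false) w = cyclicCount (1, true) (0, false) w :=
    (pairCount_bar _ _ _).symm
  have hs := isPermutation_swapAB.mem_C2 hw
  rw [h1, h2, posB_inv_eq, MulAut.mul_apply, MulAut.mul_apply, MulAut.mul_apply,
    MulAut.mul_apply, isPermutation_swapAB.cyclicLen_eq, isPermutation_negB.cyclicLen_eq,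
    cyclicLen_posA_eq (isPermutation_negB.mem_C2 hs), isPermutation_negB.len_eq,
    isPermutation_swapAB.len_eq,
    ← cyclicCount_swapAB (1, true) (1, true) w, ← cyclicCount_swapAB (1, true) (0, false) w,
    ← cyclicCount_swapAB (1, true) (0, true) w, ← cyclicCount_negB _ _ (swapAB w),
    ← cyclicCount_negB _ _ (swapAB w), ← cyclicCount_negB _ _ (swapAB w)]
  rfl

end FreeGroupTwo

/-! ### Drift and monotonicity of length -/

namespace FreeGroupTwo

theorem cyclicLen_map_conj (φ : MulAut F2) (g w : F2) :
    cyclicLen (φ (g * w * g⁻¹)) = cyclicLen (φ w) := by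
  simp only [map_mul, map_inv, cyclicLen_conj]

theorem exists_increments (w : F2) : ∃ (A B : ℕ) (D : ℤ),
    (cyclicLen (posA w) : ℤ) = cyclicLen w + A + D ∧
    (cyclicLen (posA⁻¹ w) : ℤ) = cyclicLen w + A - D ∧
    (cyclicLen (posB w) : ℤ) = cyclicLen w + B + D ∧
    (cyclicLen (posB⁻¹ w) : ℤ) = cyclicLen w + B - D := by
  obtain ⟨g, hg, hl⟩ := exists_conj_mem_C2 w
  refine ⟨cyclicCount (0, true) (0, true) (g * w * g⁻¹),
    cyclicCount (1, true) (1, true) (g * w * g⁻¹), cyclicCount (0, true) (1, true) (g * w * g⁻¹) -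
    cyclicCount (0, true) (1, false) (g * w * g⁻¹), ?_⟩
  rw [← hl, ← cyclicLen_map_conj posA g, ← cyclicLen_map_conj posA⁻¹ g,
    ← cyclicLen_map_conj posB g, ← cyclicLen_map_conj posB⁻¹ g, cyclicLen_posA_eq hg,
    cyclicLen_posA_inv_eq hg, cyclicLen_posB_eq hg, cyclicLen_posB_inv_eq hg]
  refine ⟨?_, ?_, ?_, ?_⟩ <;> ring

/-- Twice the quantity `(ab)_w - (ab⁻¹)_w` of a cyclic reduction of `w`. -/
def drift (w : F2) : ℤ := cyclicLen (posA w) - cyclicLen (posA⁻¹ w)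

theorem posA_posA_inv (w : F2) : posA (posA⁻¹ w) = w := by simp
theorem posA_inv_posA (w : F2) : posA⁻¹ (posA w) = w := by simp
theorem posB_posB_inv (w : F2) : posB (posB⁻¹ w) = w := by simp
theorem posB_inv_posB (w : F2) : posB⁻¹ (posB w) = w := by simp

/-- The submonoid generated by the automorphisms `({a}, b)` and `({b}, a)`. -/
def Pos : Submonoid (MulAut F2) := Submonoid.closure {posA, posB}

/-- The submonoid generated by the inverses of the automorphisms `({a}, b)` and `({b}, a)`. -/
def Neg : Submonoid (MulAut F2) := Submonoid.closure {posA⁻¹, posB⁻¹}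

/-- With increments A, D at `w` and A', D' at the image under `posA`, the inverse move leads back,
so A' - D' = -(A + D). Hence D' = A' + A + D ≥ D. The other move works alike with B. -/
theorem drift_pos_step {w : F2} {s : MulAut F2} (hs : s ∈ ({posA, posB} : Set (MulAut F2))) :
    (0 ≤ drift w → cyclicLen w ≤ cyclicLen (s w) ∧ 0 ≤ drift (s w)) ∧
    (0 < drift w → cyclicLen w < cyclicLen (s w) ∧ 0 < drift (s w)) := by
  obtain ⟨A, B, D, h1, h2, h3, h4⟩ := exists_increments w
  obtain ⟨A', B', D', h1', h2', h3', h4'⟩ := exists_increments (s w)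
  simp only [drift]
  rcases hs with rfl | rfl
  · rw [posA_inv_posA] at h2' ⊢
    constructor <;> intro h <;> constructor <;> omega
  · rw [posB_inv_posB] at h4'
    constructor <;> intro h <;> constructor <;> omega

theorem drift_neg_step {w : F2} {s : MulAut F2} (hs : s ∈ ({posA⁻¹, posB⁻¹} : Set (MulAut F2))) :
    (drift w ≤ 0 → cyclicLen w ≤ cyclicLen (s w) ∧ drift (s w) ≤ 0) ∧
    (drift w < 0 → cyclicLen w < cyclicLen (s w) ∧ drift (s w) < 0) := by
  obtain ⟨A, B, D, h1, h2, h3, h4⟩ := exists_increments w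
  obtain ⟨A', B', D', h1', h2', h3', h4'⟩ := exists_increments (s w)
  simp only [drift]
  rcases hs with rfl | rfl
  · rw [posA_posA_inv] at h1' ⊢
    constructor <;> intro h <;> constructor <;> omega
  · rw [posB_posB_inv] at h3'
    constructor <;> intro h <;> constructor <;> omega

theorem cyclicLen_le_of_drift_nonneg {w : F2} (hw : 0 ≤ drift w) {m : MulAut F2} (hm : m ∈ Pos) :
    cyclicLen w ≤ cyclicLen (m w) := by
  suffices cyclicLen w ≤ cyclicLen (m w) ∧ 0 ≤ drift (m w) from this.1
  induction hm using Submonoid.closure_induction_left with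
  | one => exact ⟨le_rfl, hw⟩
  | mul_left s hs m hm ih =>
    have := (drift_pos_step (w := m w) hs).1 ih.2
    exact ⟨ih.1.trans this.1, this.2⟩

theorem cyclicLen_le_of_drift_nonpos {w : F2} (hw : drift w ≤ 0) {m : MulAut F2} (hm : m ∈ Neg) :
    cyclicLen w ≤ cyclicLen (m w) := by
  suffices cyclicLen w ≤ cyclicLen (m w) ∧ drift (m w) ≤ 0 from this.1
  induction hm using Submonoid.closure_induction_left with
  | one => exact ⟨le_rfl, hw⟩
  | mul_left s hs m hm ih =>
    have := (drift_neg_step (w := m w) hs).1 ih.2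
    exact ⟨ih.1.trans this.1, this.2⟩

theorem eq_one_of_drift_pos {w : F2} (hw : 0 < drift w) {m : MulAut F2} (hm : m ∈ Pos)
    (h : cyclicLen (m w) ≤ cyclicLen w) : m = 1 := by
  suffices m = 1 ∨ cyclicLen w < cyclicLen (m w) ∧ 0 < drift (m w) from
    this.resolve_right fun h' => absurd h'.1 (not_lt.2 h)
  clear h
  induction hm using Submonoid.closure_induction_left with
  | one => exact Or.inl rfl
  | mul_left s hs m hm ih =>
    right
    rcases ih with rfl | ih
    · exact (drift_pos_step hs).2 hw
    · have := (drift_pos_step (w := m w) hs).2 ih.2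
      exact ⟨ih.1.trans this.1, this.2⟩

theorem eq_one_of_drift_neg {w : F2} (hw : drift w < 0) {m : MulAut F2} (hm : m ∈ Neg)
    (h : cyclicLen (m w) ≤ cyclicLen w) : m = 1 := by
  suffices m = 1 ∨ cyclicLen w < cyclicLen (m w) ∧ drift (m w) < 0 from
    this.resolve_right fun h' => absurd h'.1 (not_lt.2 h)
  clear h
  induction hm using Submonoid.closure_induction_left with
  | one => exact Or.inl rfl
  | mul_left s hs m hm ih =>
    right
    rcases ih with rfl | ih
    · exact (drift_neg_step hs).2 hw
    · have := (drift_neg_step (w := m w) hs).2 ih.2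
      exact ⟨ih.1.trans this.1, this.2⟩

@[simp] theorem posA_symm_a : (MulEquiv.symm posA : F2 ≃* F2) a = a * b⁻¹ := posA_inv_a

@[simp] theorem posA_symm_b : (MulEquiv.symm posA : F2 ≃* F2) b = b := posA_inv_b

@[simp] theorem posB_symm_a : (MulEquiv.symm posB : F2 ≃* F2) a = a := posB_inv_a

@[simp] theorem posB_symm_b : (MulEquiv.symm posB : F2 ≃* F2) b = b * a⁻¹ := posB_inv_b

theorem conj_mem_J (g : F2) : MulAut.conj g ∈ J := Inn_le_J ⟨g, rfl⟩

theorem swapAB_mem_J : swapAB ∈ J := isPermutation_swapAB.mem_J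

theorem negB_mem_J : negB ∈ J := isPermutation_negB.mem_J

/-- The triangle relations: a move followed by a move of the opposite sign on the other generator
is, up to `J`, a single move of the sign of the first. -/
theorem exists_posB_inv_mul_posA : ∃ j ∈ J, posB⁻¹ * posA = j * posB :=
  ⟨MulAut.conj a * swapAB * negB,
    J.mul_mem (J.mul_mem (conj_mem_J a) swapAB_mem_J) negB_mem_J,
    by apply aut_ext <;> simp [mul_assoc]⟩

theorem exists_posA_inv_mul_posB : ∃ j ∈ J, posA⁻¹ * posB = j * posA :=
  ⟨MulAut.conj b * negB * swapAB * negB * negB,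
    by
      have := conj_mem_J b
      have := swapAB_mem_J
      have := negB_mem_J
      apply_rules [J.mul_mem],
    by apply aut_ext <;> simp [mul_assoc]⟩

theorem exists_posB_mul_posA_inv : ∃ j ∈ J, posB * posA⁻¹ = j * posB⁻¹ :=
  ⟨MulAut.conj b * negB * swapAB,
    J.mul_mem (J.mul_mem (conj_mem_J b) negB_mem_J) swapAB_mem_J,
    by apply aut_ext <;> simp [mul_assoc]⟩

theorem exists_posA_mul_posB_inv : ∃ j ∈ J, posA * posB⁻¹ = j * posA⁻¹ :=
  ⟨MulAut.conj a * swapAB * negB,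
    J.mul_mem (J.mul_mem (conj_mem_J a) swapAB_mem_J) negB_mem_J,
    by apply aut_ext <;> simp [mul_assoc]⟩

end FreeGroupTwo

/-! ### Nielsen's theorem in rank two -/

namespace FreeGroupTwo

open FreeGroup (mk mul_mk one_eq_mk isReduced_toWord)

/-- The length of the longest common prefix of two lists. -/
def commonPrefixLength : List (Fin 2 × Bool) → List (Fin 2 × Bool) → ℕ
  | p :: s, q :: t => if p = q then commonPrefixLength s t + 1 else 0
  | _, _ => 0

theorem commonPrefixLength_comm (l m : List (Fin 2 × Bool)) :
    commonPrefixLength l m = commonPrefixLength m l := by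
  fun_induction commonPrefixLength l m with
  | case1 s q t ih => simp [commonPrefixLength, ih]
  | case2 p s q t h => simp [commonPrefixLength, Ne.symm h]
  | case3 l m h =>
    rcases l with - | ⟨p, l⟩ <;> rcases m with - | ⟨q, m⟩ <;> simp [commonPrefixLength]
    exact (h p l q m rfl rfl).elim

/-- The ultrametric inequality of the tree of words. -/
theorem min_commonPrefixLength_le (l m k : List (Fin 2 × Bool)) :
    min (commonPrefixLength l m) (commonPrefixLength m k) ≤ commonPrefixLength l k := by
  induction l generalizing m k with
  | nil => simp [commonPrefixLength]
  | cons p l ih =>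
    rcases m with - | ⟨q, m⟩ <;> rcases k with - | ⟨r, k⟩ <;> simp only [commonPrefixLength] <;>
      try simp
    have := ih m k
    split_ifs <;> simp_all

theorem take_commonPrefixLength (l m : List (Fin 2 × Bool)) :
    l.take (commonPrefixLength l m) = m.take (commonPrefixLength l m) := by
  fun_induction commonPrefixLength l m with
  | case1 s q t ih => simp [ih]
  | case2 p s q t h => simp
  | case3 l m h => simp

theorem invRev_cons_eq (p : Fin 2 × Bool) (l : List (Fin 2 × Bool)) :
    FreeGroup.invRev (p :: l) = FreeGroup.invRev l ++ [bar p] := by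
  simp [FreeGroup.invRev, bar]

theorem len_mk_invRev_append (l m : List (Fin 2 × Bool)) (hl : FreeGroup.IsReduced l)
    (hm : FreeGroup.IsReduced m) :
    len (mk (FreeGroup.invRev l ++ m)) + 2 * commonPrefixLength l m = l.length + m.length := by
  have len_mk : ∀ {k : List (Fin 2 × Bool)}, FreeGroup.IsReduced k → len (mk k) = k.length :=
    fun h => by rw [len, FreeGroup.toWord_mk, h.reduce_eq]
  have hr : ∀ {k : List (Fin 2 × Bool)}, FreeGroup.IsReduced k →
      FreeGroup.IsReduced (FreeGroup.invRev k) := fun {k} h => by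
    rw [FreeGroup.isReduced_iff_reduce_eq, FreeGroup.reduce_invRev, h.reduce_eq]
  fun_induction commonPrefixLength l m with
  | case1 s q t ih =>
    have e : (mk (FreeGroup.invRev (q :: s) ++ q :: t) : F2) = mk (FreeGroup.invRev s ++ t) := by
      rw [← mul_mk, ← mul_mk, ← FreeGroup.inv_mk, ← FreeGroup.inv_mk, mk_cons_eq q s,
        mk_cons_eq q t]
      group
    rw [e]
    have := ih hl.tail hm.tail
    simp only [List.length_cons]
    omega
  | case2 p s q t h =>
    rw [len_mk]
    · simp
    · have e : ∀ p q : Fin 2 × Bool, p ≠ q → ((bar p).1 = q.1 → (bar p).2 = q.2) := by decide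
      have h1 := hr hl
      rw [invRev_cons_eq] at h1 ⊢
      refine List.IsChain.append h1 hm ?_
      simpa using e p q h
  | case3 l m h =>
    rcases l with - | ⟨p, l⟩
    · simp [len_mk hm]
    · rcases m with - | ⟨q, m⟩
      · rw [List.append_nil, len_mk (hr hl)]; simp
      · exact (h p l q m rfl rfl).elim

/-- The length of the longest common prefix of two elements of the free group. -/
def commonPrefix (u v : F2) : ℕ := commonPrefixLength u.toWord v.toWord

theorem len_inv_mul (u v : F2) : len (u⁻¹ * v) + 2 * commonPrefix u v = len u + len v := by
  have := len_mk_invRev_append u.toWord v.toWord isReduced_toWord isReduced_toWord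
  rwa [← mul_mk, ← FreeGroup.inv_mk, FreeGroup.mk_toWord, FreeGroup.mk_toWord] at this

theorem commonPrefix_comm (u v : F2) : commonPrefix u v = commonPrefix v u :=
  commonPrefixLength_comm _ _

theorem min_commonPrefix_le (u v w : F2) :
    min (commonPrefix u v) (commonPrefix v w) ≤ commonPrefix u w :=
  min_commonPrefixLength_le _ _ _

theorem commonPrefix_mul (u v : F2) : commonPrefix u (u * v) + commonPrefix u⁻¹ v = len u := by
  have h1 := len_inv_mul u (u * v)
  have h2 := len_inv_mul u⁻¹ v
  rw [inv_mul_cancel_left] at h1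
  rw [inv_inv, len_inv] at h2
  omega

theorem len_eq_zero {w : F2} : len w = 0 ↔ w = 1 := FreeGroup.norm_eq_zero

/-- Squaring adds exactly `cyclicLen u` to the length, which is positive, so less than half of `u`
cancels in `u * u`. -/
theorem two_mul_commonPrefix_inv_lt {u : F2} (hu : u ≠ 1) : 2 * commonPrefix u⁻¹ u < len u := by
  have h1 := len_inv_mul u⁻¹ u
  have h2 := len_pow u 0
  have h3 := len_pow u 1
  rw [inv_inv, len_inv] at h1
  simp only [zero_add, one_mul, pow_succ, pow_zero] at h2 h3
  have h4 : cyclicLen u ≠ 0 := fun h => hu <| by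
    obtain ⟨g, -, hl⟩ := exists_conj_mem_C2 u
    rw [h, len_eq_zero] at hl
    simpa using hl
  omega

theorem mk_bar (p : Fin 2 × Bool) : (mk [bar p] : F2) = (mk [p])⁻¹ := by
  rw [FreeGroup.inv_mk]; rfl

theorem mk_singleton_ne_one (p : Fin 2 × Bool) : (mk [p] : F2) ≠ 1 := fun h => by
  simpa using congrArg FreeGroup.toWord h

/-- An automorphism does not decrease lengths if the images of the letters form a Nielsen reduced
system. -/
theorem len_le_of_nielsen_reduced (φ : MulAut F2)
    (h1 : ∀ p q : Fin 2 × Bool, p ≠ q → 2 * commonPrefix (φ (mk [p])) (φ (mk [q])) ≤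
      len (φ (mk [p])))
    (h2 : ∀ p r q : Fin 2 × Bool, r ≠ bar p → q ≠ bar r →
      commonPrefix (φ (mk [bar p])) (φ (mk [r])) + commonPrefix (φ (mk [bar r])) (φ (mk [q])) <
        len (φ (mk [r]))) (g : F2) : len g ≤ len (φ g) := by
  have e : ∀ p q : Fin 2 × Bool, (p.1 = q.1 → p.2 = q.2) ↔ q ≠ bar p := by decide
  -- Here `r` is the preceding letter. The induction carries along that cancellation with its image
  -- depends only on the image of `p`.
  have key : ∀ (t : List (Fin 2 × Bool)) (p r : Fin 2 × Bool), FreeGroup.IsReduced (p :: t) →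
      p ≠ bar r → commonPrefix (φ (mk [bar r])) (φ (mk (p :: t))) =
        commonPrefix (φ (mk [bar r])) (φ (mk [p])) ∧
      (p :: t).length + commonPrefix (φ (mk [bar r])) (φ (mk [p])) ≤ len (φ (mk (p :: t))) := by
    intro t
    induction t with
    | nil =>
      intro p r _ hpr
      have h3 := h1 p (bar r) hpr
      have h4 : len (φ (mk [p])) ≠ 0 := by
        rw [Ne, len_eq_zero, map_eq_one_iff φ φ.injective]
        exact mk_singleton_ne_one p
      rw [commonPrefix_comm] at h3
      refine ⟨rfl, ?_⟩
      simp only [List.length_singleton]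
      omega
    | cons q t ih =>
      intro p r hred hpr
      have hqp : q ≠ bar p := (e p q).1 (FreeGroup.isReduced_cons_cons.1 hred).1
      obtain ⟨i1, i2⟩ := ih q p hred.tail hqp
      have h3 := h2 r p q hpr hqp
      have h4 := commonPrefix_mul (φ (mk [p])) (φ (mk (q :: t)))
      have h5 := len_inv_mul (φ (mk [bar p])) (φ (mk (q :: t)))
      have h6 : (φ (mk [bar p]))⁻¹ = φ (mk [p]) := by rw [mk_bar, map_inv, inv_inv]
      have h7 : (φ (mk [p]))⁻¹ = φ (mk [bar p]) := by rw [mk_bar, map_inv]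
      rw [h7, ← map_mul, ← mk_cons_eq, i1] at h4
      rw [h6, ← map_mul, ← mk_cons_eq, i1, ← h7, len_inv, h7] at h5
      -- By `h3` and `h4` the image of the word follows that of `p` beyond the point where the
      -- latter leaves the image of `bar r`. The ultrametric inequality, used both ways, then gives
      -- equality.
      have h8 := min_commonPrefix_le (φ (mk [bar r])) (φ (mk [p])) (φ (mk (p :: q :: t)))
      have h9 := min_commonPrefix_le (φ (mk [bar r])) (φ (mk (p :: q :: t))) (φ (mk [p]))
      rw [commonPrefix_comm (φ (mk (p :: q :: t)))] at h9
      simp only [List.length_cons] at i2 ⊢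
      constructor <;> omega
  rw [← FreeGroup.mk_toWord (x := g)]
  have hg : FreeGroup.IsReduced g.toWord := isReduced_toWord
  rw [len, FreeGroup.toWord_mk, hg.reduce_eq]
  rcases h : g.toWord with - | ⟨p, t⟩
  · simp
  · rw [h] at hg
    have hp : ∀ p : Fin 2 × Bool, p ≠ bar p := by decide
    -- The first letter itself serves as a fictitious preceding letter.
    exact (Nat.le_add_right _ _).trans (key t p p hg (hp p)).2

/-- The inverse does not increase length, so it sends letters to nontrivial elements of length at
most one, that is, to letters. Injectivity on a finite set does the rest. -/
theorem isPermutation_of_len_le {φ : MulAut F2} (h : ∀ g, len g ≤ len (φ g)) :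
    IsPermutation φ := by
  have hfin : L2.Finite := by simp [L2]
  have hm : ∀ x : F2, x ∈ L2 ↔ len x = 1 := fun x => by
    constructor
    · intro hx
      obtain ⟨p, rfl⟩ := toWord_mem_L2 hx
      rfl
    · intro hx
      obtain ⟨p, hp⟩ := List.length_eq_one_iff.1 hx
      rw [← FreeGroup.mk_toWord (x := x), hp]
      exact mk_singleton_mem_L2 p
  obtain ⟨ψ, rfl⟩ : ∃ ψ : MulAut F2, φ = ψ⁻¹ := ⟨φ⁻¹, by simp⟩
  have hsub : ψ '' L2 ⊆ L2 := by
    rintro _ ⟨x, hx, rfl⟩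
    rw [hm] at hx ⊢
    have h1 := h (ψ x)
    have h2 : len (ψ x) ≠ 0 := by
      rw [Ne, len_eq_zero, map_eq_one_iff _ ψ.injective, ← len_eq_zero]
      omega
    have h3 : ψ⁻¹ (ψ x) = x := by simp
    rw [h3] at h1
    omega
  have heq : IsPermutation ψ := Set.eq_of_subset_of_ncard_le hsub
    (by rw [Set.ncard_image_of_injective _ ψ.injective]) hfin
  exact heq.inv

/-- The subgroup generated by `J` and the automorphisms `({a}, b)` and `({b}, a)`. -/
def ElementaryAut : Subgroup (MulAut F2) := Subgroup.closure ((J : Set (MulAut F2)) ∪ {posA, posB})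

theorem J_le_elementaryAut : J ≤ ElementaryAut :=
  fun _ h => Subgroup.subset_closure (Or.inl h)

theorem posA_mem_elementaryAut : posA ∈ ElementaryAut :=
  Subgroup.subset_closure (Or.inr (Or.inl rfl))

theorem posB_mem_elementaryAut : posB ∈ ElementaryAut :=
  Subgroup.subset_closure (Or.inr (Or.inr rfl))

theorem exists_elementaryAut_transvection {p q : Fin 2 × Bool} (hpq : p.1 ≠ q.1) :
    ∃ ψ ∈ ElementaryAut, ψ (mk [p]) = mk [p] ∧ ψ (mk [q]) = (mk [p])⁻¹ * mk [q] := by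
  have hA := posA_mem_elementaryAut
  have hB := posB_mem_elementaryAut
  have hA' := ElementaryAut.inv_mem hA
  have hB' := ElementaryAut.inv_mem hB
  have hc : ∀ g, MulAut.conj g ∈ ElementaryAut := fun g => J_le_elementaryAut (conj_mem_J g)
  obtain ⟨i, s⟩ := p
  obtain ⟨j, t⟩ := q
  fin_cases i <;> fin_cases j <;> cases s <;> cases t <;>
    simp only [Fin.mk_zero, Fin.mk_one, Fin.isValue, ne_eq, not_true_eq_false,
      mk_zero_true, mk_zero_false, mk_one_true, mk_one_false] at hpq ⊢
  · exact ⟨posB⁻¹, hB', by simp, by simp⟩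
  · exact ⟨MulAut.conj a * posB, ElementaryAut.mul_mem (hc a) hB, by simp, by simp [mul_assoc]⟩
  · exact ⟨posB, hB, by simp, by simp⟩
  · exact ⟨MulAut.conj a⁻¹ * posB⁻¹, ElementaryAut.mul_mem (hc _) hB', by simp,
      by simp [mul_assoc]⟩
  · exact ⟨posA⁻¹, hA', by simp, by simp⟩
  · exact ⟨MulAut.conj b * posA, ElementaryAut.mul_mem (hc b) hA, by simp, by simp [mul_assoc]⟩
  · exact ⟨posA, hA, by simp, by simp⟩
  · exact ⟨MulAut.conj b⁻¹ * posA⁻¹, ElementaryAut.mul_mem (hc _) hA', by simp,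
      by simp [mul_assoc]⟩

/-- The borderline case in which exactly half of `u` cancels on each side. The halves P, Q of `u`
are a prefix and a suffix of `v`, disjoint as `v` is long enough. The pair (u, u⁻¹v) is conjugate by
Q to (QP, m), which is shorter in total than (u, v) when `u` is nontrivial. -/
theorem exists_factorization_of_commonPrefix {u v : F2} {h : ℕ} (hu : 2 * h = len u)
    (huv : len u ≤ len v) (h1 : commonPrefix v u = h) (h2 : commonPrefix u⁻¹ v⁻¹ = h) :
    ∃ P Q m : F2, u = P * Q ∧ v = P * m * Q ∧ len (Q * P) ≤ len u ∧ len m + len u ≤ len v := by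
  have e1 := take_commonPrefixLength v.toWord u.toWord
  have e2 := take_commonPrefixLength u⁻¹.toWord v⁻¹.toWord
  rw [commonPrefix] at h1 h2
  rw [h1] at e1
  rw [h2, FreeGroup.toWord_inv, FreeGroup.toWord_inv] at e2
  simp only [FreeGroup.invRev, List.take_reverse, List.length_map, List.reverse_inj,
    ← List.map_drop] at e2
  have e3 := List.map_injective_iff.2
    (show Function.Injective fun x : Fin 2 × Bool => (x.1, !x.2) by decide) e2
  rw [len, len] at *
  have hd : u.toWord.length - h = h := by omega
  rw [hd] at e3
  have lm : ∀ l : List (Fin 2 × Bool), (mk l : F2).toWord.length ≤ l.length :=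
    fun l => FreeGroup.norm_mk_le
  refine ⟨mk (u.toWord.take h), mk (u.toWord.drop h),
    mk ((v.toWord.take (v.toWord.length - h)).drop h), ?_, ?_, ?_, ?_⟩
  · rw [mul_mk, List.take_append_drop, FreeGroup.mk_toWord]
  · rw [← e1, e3, mul_mk, mul_mk]
    have : v.toWord.take h = (v.toWord.take (v.toWord.length - h)).take h := by
      rw [List.take_take, min_eq_left (by omega)]
    rw [this, List.take_append_drop, List.take_append_drop, FreeGroup.mk_toWord]
  · rw [mul_mk]
    refine (lm _).trans ?_
    simp
    omega
  · have : len (mk ((v.toWord.take (v.toWord.length - h)).drop h)) ≤ _ := lm _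
    simp only [List.length_drop, List.length_take] at this
    omega

theorem len_map_add_len_map {p q : Fin 2 × Bool} (hpq : p.1 ≠ q.1) (φ : MulAut F2) :
    len (φ (mk [p])) + len (φ (mk [q])) = len (φ a) + len (φ b) := by
  obtain ⟨i, s⟩ := p
  obtain ⟨j, t⟩ := q
  fin_cases i <;> fin_cases j <;> cases s <;> cases t <;>
    simp only [Fin.mk_zero, Fin.mk_one, Fin.isValue, ne_eq, not_true_eq_false, map_inv, len_inv,
      mk_zero_true, mk_zero_false, mk_one_true, mk_one_false] at hpq ⊢ <;> exact add_comm _ _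

/-- Nielsen's theorem in rank two. -/
theorem elementaryAut_eq_top (φ : MulAut F2) : φ ∈ ElementaryAut := by
  suffices ∀ (n : ℕ) (φ : MulAut F2), len (φ a) + len (φ b) = n → φ ∈ ElementaryAut from
    this _ φ rfl
  intro n
  induction n using Nat.strong_induction_on with
  | _ n ih =>
  intro φ hn
  by_contra hφ
  -- A counterexample of least total length stays a counterexample under multiplication by the
  -- subgroup on either side, so no such product shortens it.
  have hmin : ∀ ψ ∈ ElementaryAut, ∀ χ ∈ ElementaryAut, n ≤ len ((χ * φ * ψ) a) +
      len ((χ * φ * ψ) b) := fun ψ hψ χ hχ => by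
    by_contra! hlt
    have := ih _ hlt (χ * φ * ψ) rfl
    rw [Subgroup.mul_mem_cancel_right _ hψ, Subgroup.mul_mem_cancel_left _ hχ] at this
    exact hφ this
  have hne : ∀ p : Fin 2 × Bool, φ (mk [p]) ≠ 1 := fun p => by
    rw [Ne, map_eq_one_iff φ φ.injective]
    exact mk_singleton_ne_one p
  have hself : ∀ r : Fin 2 × Bool, 2 * commonPrefix (φ (mk [bar r])) (φ (mk [r])) <
      len (φ (mk [r])) := fun r => by
    rw [mk_bar, map_inv]
    exact two_mul_commonPrefix_inv_lt (hne r)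
  have hcases : ∀ p q : Fin 2 × Bool, p = q ∨ q = bar p ∨ p.1 ≠ q.1 := by decide
  have hlbar : ∀ p, len (φ (mk [bar p])) = len (φ (mk [p])) := fun p => by
    rw [mk_bar, map_inv, len_inv]
  have h1 : ∀ p q : Fin 2 × Bool, p ≠ q → 2 * commonPrefix (φ (mk [p])) (φ (mk [q])) ≤
      len (φ (mk [p])) := by
    intro p q hpq
    rcases hcases p q with rfl | rfl | h
    · exact absurd rfl hpq
    · have := hself p
      rw [commonPrefix_comm]
      exact this.le
    · obtain ⟨ψ, hψ, hp, hq⟩ := exists_elementaryAut_transvection h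
      have h2 := hmin ψ hψ 1 ElementaryAut.one_mem
      rw [one_mul, ← len_map_add_len_map h, MulAut.mul_apply, MulAut.mul_apply, hp, hq, map_mul,
        map_inv] at h2
      have h3 := len_inv_mul (φ (mk [p])) (φ (mk [q]))
      have h4 := len_map_add_len_map h φ
      omega
  refine hφ (J_le_elementaryAut (isPermutation_of_len_le
    (len_le_of_nielsen_reduced φ h1 fun p r q hr hq => ?_)).mem_J)
  have i1 := h1 r (bar p) hr
  have i2 := h1 (bar r) q hq.symm
  rw [commonPrefix_comm] at i1
  rw [hlbar] at i2
  -- By `i1` and `i2`, failure of the second Nielsen condition means that exactly half of the image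
  -- of `r` cancels on each side. An equal neighbour is excluded, since self-cancellation stays
  -- below half.
  rcases hcases p r with rfl | rfl | hpr
  · have := hself p
    omega
  · exact absurd rfl hr
  rcases hcases r q with rfl | rfl | hrq
  · have := hself r
    omega
  · exact absurd rfl hq
  by_contra! hlt
  have hpq : p = q ∨ q = bar p := by
    revert hpr hrq
    clear * -
    revert p q r
    decide
  rcases hpq with rfl | rfl
  -- The subword p r p: the factorization gives a transvection and a conjugation which shorten the
  -- pair.
  · have hlen := h1 (bar p) r hr.symm
    obtain ⟨P, Q, m, e1, e2, e3, e4⟩ := exists_factorization_of_commonPrefix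
      (u := φ (mk [r])) (v := φ (mk [bar p])) (h := commonPrefix (φ (mk [bar p])) (φ (mk [r])))
      (by omega) (by omega) rfl (by
        rw [← map_inv, ← map_inv, ← mk_bar, ← mk_bar, bar_bar]
        omega)
    obtain ⟨ψ, hψ, er, ep⟩ := exists_elementaryAut_transvection (p := r) (q := bar p) hrq
    have hm := hmin ψ hψ (MulAut.conj Q) (J_le_elementaryAut (conj_mem_J Q))
    rw [← len_map_add_len_map (p := r) (q := bar p) hrq] at hm
    simp only [MulAut.mul_apply, er, ep, map_mul φ, map_inv φ] at hm
    rw [e2, e1] at hm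
    have s1 : MulAut.conj Q (P * Q) = Q * P := by simp [mul_assoc]
    have s2 : MulAut.conj Q ((P * Q)⁻¹ * (P * m * Q)) = m := by simp [mul_assoc]
    rw [s1, s2, ← hn, ← len_map_add_len_map (p := r) (q := bar p) hrq] at hm
    have := len_eq_zero.not.2 (hne r)
    omega
  -- The subword p r p⁻¹: the image of p⁻¹ shares half a word with the images of both r and r⁻¹,
  -- which therefore share half a word with each other, against `hself`.
  · have h5 := min_commonPrefix_le (φ (mk [bar r])) (φ (mk [bar p])) (φ (mk [r]))
    have := hself r
    omega

end FreeGroupTwo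

/-! ### Four moves modulo inner automorphisms, and factorization into moves of one sign -/

namespace FreeGroupTwo

theorem a_ne_b : a ≠ b := by decide
theorem a_ne_b_inv : a ≠ b⁻¹ := by decide
theorem a_inv_ne_b : a⁻¹ ≠ b := by decide
theorem a_ne_a_inv : a ≠ a⁻¹ := by decide
theorem b_ne_b_inv : b ≠ b⁻¹ := by decide

/-- The automorphisms `({a}, b)`, `({a}, b⁻¹)`, `({b}, a)`, `({b}, a⁻¹)`. -/
def elementaryMoves : Set (MulAut F2) := {posA, posA⁻¹, posB, posB⁻¹}

/-- There are eight one-letter automorphisms, but ({y⁻¹}, x) and ({y}, x⁻¹) differ by conjugation by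
a power of x. -/
theorem IsOneLetter.exists_move {φ : MulAut F2} (h : IsOneLetter φ) :
    ∃ s ∈ elementaryMoves, ∃ g : F2, φ = MulAut.conj g * s := by
  obtain ⟨x, y, hx, hy, hφ⟩ := h
  have hy' := hy rfl
  have ha := hφ a (Or.inl rfl)
  have hb := hφ b (Or.inr (Or.inl rfl))
  clear hφ hy
  have m1 : posA ∈ elementaryMoves := by simp [elementaryMoves]
  have m2 : posA⁻¹ ∈ elementaryMoves := by simp [elementaryMoves]
  have m3 : posB ∈ elementaryMoves := by simp [elementaryMoves]
  have m4 : posB⁻¹ ∈ elementaryMoves := by simp [elementaryMoves]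
  rcases hx with rfl | rfl | rfl | rfl <;> obtain ⟨rfl | rfl | rfl | rfl, hy⟩ := hy' <;>
    simp only [Set.mem_singleton_iff, Set.mem_insert_iff, inv_inv, true_or, or_true,
      not_true_eq_false, a_ne_b, a_ne_b_inv, a_ne_a_inv, b_ne_b_inv,
      a_ne_b.symm, a_ne_b_inv.symm, a_inv_ne_b.symm, a_ne_a_inv.symm, b_ne_b_inv.symm,
      if_true, if_false, one_mul, mul_one, inv_eq_iff_eq_inv] at ha hb hy
  · exact ⟨_, m3, 1, aut_ext (by simp [ha]) (by simp [hb])⟩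
  · exact ⟨_, m4, a⁻¹, aut_ext (by simp [ha]) (by simp [hb, mul_assoc])⟩
  · exact ⟨_, m1, 1, aut_ext (by simp [ha]) (by simp [hb])⟩
  · exact ⟨_, m2, b⁻¹, aut_ext (by simp [ha, mul_assoc]) (by simp [hb])⟩
  · exact ⟨_, m4, 1, aut_ext (by simp [ha]) (by simp [hb])⟩
  · exact ⟨_, m3, a, aut_ext (by simp [ha]) (by simp [hb, mul_assoc])⟩
  · exact ⟨_, m2, 1, aut_ext (by simp [ha]) (by simp [hb])⟩
  · exact ⟨_, m1, b, aut_ext (by simp [ha, mul_assoc]) (by simp [hb])⟩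

theorem isOneLetter_of_mem_moves {s : MulAut F2} (hs : s ∈ elementaryMoves) : IsOneLetter s := by
  rcases hs with rfl | rfl | rfl | rfl
  on_goal 1 => refine ⟨b, a, by simp [L2], ?_, ?_⟩
  on_goal 3 => refine ⟨b⁻¹, a, by simp [L2], ?_, ?_⟩
  on_goal 5 => refine ⟨a, b, by simp [L2], ?_, ?_⟩
  on_goal 7 => refine ⟨a⁻¹, b, by simp [L2], ?_, ?_⟩
  all_goals first
    | (rintro _ rfl
       refine ⟨by simp [L2], ?_⟩
       simp only [Set.mem_singleton_iff, Set.mem_insert_iff, inv_inv, a_ne_b, a_ne_b_inv,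
         a_ne_b.symm, a_inv_ne_b.symm, or_self, not_false_eq_true])
    | (rintro _ (rfl | rfl | rfl | rfl) <;>
       simp only [Set.mem_singleton_iff, inv_inv, a_ne_b, a_inv_ne_b, a_ne_b.symm,
         a_ne_b_inv.symm, a_ne_a_inv.symm, b_ne_b_inv.symm, if_true, if_false, one_mul, mul_one, map_inv, posA_a, posA_b,
         posB_a, posB_b, posA_inv_a, posA_inv_b, posB_inv_a, posB_inv_b, mul_inv_rev])

theorem exists_conj_mul_of_coe_eq {φ ψ : MulAut F2} (h : (φ : MulAut F2 ⧸ Inn) = ψ) :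
    ∃ g : F2, φ = MulAut.conj g * ψ := by
  obtain ⟨g, hg⟩ := QuotientGroup.eq_iff_div_mem.1 h
  exact ⟨g, by rw [hg]; simp⟩

theorem coe_conj_mul (g : F2) (φ : MulAut F2) :
    ((MulAut.conj g * φ : MulAut F2) : MulAut F2 ⧸ Inn) = φ :=
  QuotientGroup.eq_iff_div_mem.2 (by simpa using ⟨g, rfl⟩)

/-- A move of the wrong sign either cancels the leftmost factor of `m` or is absorbed into it by a
triangle relation. -/
theorem mul_mem_of_move {s m : MulAut F2} (hs : s ∈ elementaryMoves) (hm : m ∈ Pos ∨ m ∈ Neg) :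
    ∃ j ∈ J, ∃ m', (m' ∈ Pos ∨ m' ∈ Neg) ∧ s * m = j * m' := by
  have p1 : posA ∈ Pos := Submonoid.subset_closure (Or.inl rfl)
  have p2 : posB ∈ Pos := Submonoid.subset_closure (Or.inr rfl)
  have n1 : posA⁻¹ ∈ Neg := Submonoid.subset_closure (Or.inl rfl)
  have n2 : posB⁻¹ ∈ Neg := Submonoid.subset_closure (Or.inr rfl)
  have key : ∀ {s t t' m : MulAut F2}, (∃ j ∈ J, s * t = j * t') →
      (t' * m ∈ Pos ∨ t' * m ∈ Neg) →
      ∃ j ∈ J, ∃ m', (m' ∈ Pos ∨ m' ∈ Neg) ∧ s * (t * m) = j * m' := by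
    rintro s t t' m ⟨j, hj, e⟩ h
    exact ⟨j, hj, _, h, by rw [← mul_assoc, e, mul_assoc]⟩
  have easy : ∀ {s m : MulAut F2}, (s * m ∈ Pos ∨ s * m ∈ Neg) →
      ∃ j ∈ J, ∃ m', (m' ∈ Pos ∨ m' ∈ Neg) ∧ s * m = j * m' :=
    fun h => ⟨1, J.one_mem, _, h, (one_mul _).symm⟩
  have cancel : ∀ {s t m : MulAut F2}, s * t = 1 → (m ∈ Pos ∨ m ∈ Neg) →
      ∃ j ∈ J, ∃ m', (m' ∈ Pos ∨ m' ∈ Neg) ∧ s * (t * m) = j * m' :=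
    fun e h => ⟨1, J.one_mem, _, h, by rw [← mul_assoc, e]⟩
  rcases hm with hm | hm
  · rcases hs with rfl | rfl | rfl | rfl
    · exact easy (Or.inl (Pos.mul_mem p1 hm))
    · induction hm using Submonoid.closure_induction_left with
      | one => exact easy (Or.inr (by simpa using n1))
      | mul_left t ht m hm _ =>
        rcases ht with rfl | rfl
        · exact cancel (by simp) (Or.inl hm)
        · exact key exists_posA_inv_mul_posB (Or.inl (Pos.mul_mem p1 hm))
    · exact easy (Or.inl (Pos.mul_mem p2 hm))
    · induction hm using Submonoid.closure_induction_left with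
      | one => exact easy (Or.inr (by simpa using n2))
      | mul_left t ht m hm _ =>
        rcases ht with rfl | rfl
        · exact key exists_posB_inv_mul_posA (Or.inl (Pos.mul_mem p2 hm))
        · exact cancel (by simp) (Or.inl hm)
  · rcases hs with rfl | rfl | rfl | rfl
    · induction hm using Submonoid.closure_induction_left with
      | one => exact easy (Or.inl (by simpa using p1))
      | mul_left t ht m hm _ =>
        rcases ht with rfl | rfl
        · exact cancel (by simp) (Or.inr hm)
        · exact key exists_posA_mul_posB_inv (Or.inr (Neg.mul_mem n1 hm))
    · exact easy (Or.inr (Neg.mul_mem n1 hm))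
    · induction hm using Submonoid.closure_induction_left with
      | one => exact easy (Or.inl (by simpa using p2))
      | mul_left t ht m hm _ =>
        rcases ht with rfl | rfl
        · exact key exists_posB_mul_posA_inv (Or.inr (Neg.mul_mem n2 hm))
        · exact cancel (by simp) (Or.inr hm)
    · exact easy (Or.inr (Neg.mul_mem n2 hm))

/-- Every automorphism is, up to `J`, a product of the automorphisms `({a}, b)`, `({b}, a)`, or a
product of their inverses. -/
theorem exists_J_mul_monotone (φ : MulAut F2) :
    ∃ j ∈ J, ∃ m, (m ∈ Pos ∨ m ∈ Neg) ∧ φ = j * m := by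
  have step : ∀ {s φ : MulAut F2}, s ∈ elementaryMoves →
      (∃ j ∈ J, ∃ m, (m ∈ Pos ∨ m ∈ Neg) ∧ φ = j * m) →
      ∃ j ∈ J, ∃ m, (m ∈ Pos ∨ m ∈ Neg) ∧ s * φ = j * m := by
    rintro s φ hs ⟨j, hj, m, hm, rfl⟩
    -- Conjugation by `J` permutes the classes of one-letter automorphisms, so `s` can be carried
    -- past `j`.
    obtain ⟨t, ht, e⟩ := IsOneLetter.conj_J (J.inv_mem hj) s (isOneLetter_of_mem_moves hs)
    obtain ⟨s', hs', g, rfl⟩ := ht.exists_move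
    obtain ⟨j', hj', m', hm', e'⟩ := mul_mem_of_move hs' hm
    have e2 : ((s * j : MulAut F2) : MulAut F2 ⧸ Inn) = (j * (MulAut.conj g * s') : MulAut F2) := by
      change (s : MulAut F2 ⧸ Inn) * j = j * ((MulAut.conj g * s' : MulAut F2) : MulAut F2 ⧸ Inn)
      rw [e]
      simp [mul_assoc]
    obtain ⟨h, e3⟩ := exists_conj_mul_of_coe_eq e2
    refine ⟨MulAut.conj h * j * MulAut.conj g * j', ?_, m', hm', ?_⟩
    · exact J.mul_mem (J.mul_mem (J.mul_mem (conj_mem_J h) hj) (conj_mem_J g)) hj'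
    · rw [← mul_assoc, e3]
      simp only [mul_assoc]
      rw [e']
  have hφ : φ ∈ Subgroup.closure ((J : Set (MulAut F2)) ∪ {posA, posB}) := elementaryAut_eq_top φ
  induction hφ using Subgroup.closure_induction_left with
  | one => exact ⟨1, J.one_mem, 1, Or.inl Pos.one_mem, by simp⟩
  | mul_left x hx y _ ih =>
    rcases hx with hx | rfl | rfl
    · obtain ⟨j, hj, m, hm, rfl⟩ := ih
      exact ⟨x * j, J.mul_mem hx hj, m, hm, (mul_assoc _ _ _).symm⟩
    · exact step (by simp [elementaryMoves]) ih
    · exact step (by simp [elementaryMoves]) ih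
  | inv_mul_cancel x hx y _ ih =>
    rcases hx with hx | rfl | rfl
    · obtain ⟨j, hj, m, hm, rfl⟩ := ih
      exact ⟨x⁻¹ * j, J.mul_mem (J.inv_mem hx) hj, m, hm, (mul_assoc _ _ _).symm⟩
    · exact step (by simp [elementaryMoves]) ih
    · exact step (by simp [elementaryMoves]) ih

end FreeGroupTwo

/-! ### The triangle of minimal words -/

namespace FreeGroupTwo

theorem cyclicLen_eq_of_JRel {u v : F2} (h : JRel u v) : cyclicLen u = cyclicLen v := by
  obtain ⟨j, hj, rfl⟩ := h
  exact (cyclicLen_of_mem_J hj u).symm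

theorem JRel_mul_left {j : MulAut F2} (hj : j ∈ J) (u : F2) : JRel u (j u) := ⟨j, hj, rfl⟩

theorem isMinimal_iff {v : F2} : IsMinimal v ↔ ∀ φ : MulAut F2, len v ≤ cyclicLen (φ v) := by
  refine ⟨fun h φ => ?_, fun h φ => (h φ).trans (cyclicLen_le_len _)⟩
  obtain ⟨g, -, hg⟩ := exists_conj_mem_C2 (φ v)
  rw [← hg]
  exact h (MulAut.conj g * φ)

theorem IsMinimal.len_eq {v : F2} (h : IsMinimal v) : len v = cyclicLen v :=
  le_antisymm (isMinimal_iff.1 h 1) (cyclicLen_le_len v)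

/-- When two moves of a triangle preserve the length, the drifts at its vertices point out of the
triangle, or vanish. -/
theorem drift_signs_of_triangle {w : F2} (hA : cyclicLen (posA w) = cyclicLen w)
    (hB : cyclicLen (posB w) = cyclicLen w) :
    drift w ≤ 0 ∧ 0 ≤ drift (posA w) ∧ 0 ≤ drift (posB w) := by
  obtain ⟨A, B, D, h1, h2, h3, h4⟩ := exists_increments w
  obtain ⟨A', B', D', h1', h2', h3', h4'⟩ := exists_increments (posA w)
  obtain ⟨A'', B'', D'', h1'', h2'', h3'', h4''⟩ := exists_increments (posB w)
  simp only [drift]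
  rw [posA_inv_posA] at h2' ⊢
  rw [posB_inv_posB] at h4''
  -- At `w` both A + D and B + D vanish, so D = -A ≤ 0. At the other vertices the move back to `w`
  -- preserves the length, so D' = A' ≥ 0 and D'' = B'' ≥ 0.
  refine ⟨?_, ?_, ?_⟩ <;> omega

/-- If the two moves of a triangle at `w` preserve the length, then `w` has the least length among
its automorphic images. If moreover all moves out of the triangle increase the length, then this
length is attained on the triangle only. -/
theorem triangle_minimal {w : F2} (hA : cyclicLen (posA w) = cyclicLen w)
    (hB : cyclicLen (posB w) = cyclicLen w) (φ : MulAut F2) :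
    cyclicLen w ≤ cyclicLen (φ w) ∧ (drift w < 0 → 0 < drift (posA w) → 0 < drift (posB w) →
      cyclicLen (φ w) ≤ cyclicLen w →
        JRel w (φ w) ∨ JRel (posA w) (φ w) ∨ JRel (posB w) (φ w)) := by
  obtain ⟨d1, d2, d3⟩ := drift_signs_of_triangle hA hB
  obtain ⟨j, hj, m, hm, rfl⟩ := exists_J_mul_monotone φ
  rw [MulAut.mul_apply, cyclicLen_of_mem_J hj]
  rcases hm with hm | hm
  -- Splitting off the rightmost factor exposes the move applied first; it leads to another vertex
  -- of the triangle, where the drift suits the remaining positive moves.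
  · induction hm using Submonoid.closure_induction_right with
    | one => exact ⟨le_rfl, fun _ _ _ _ => Or.inl (JRel_mul_left hj w)⟩
    | mul_right m hm s hs _ =>
      rw [MulAut.mul_apply]
      rcases hs with rfl | rfl
      · refine ⟨hA ▸ cyclicLen_le_of_drift_nonneg d2 hm, fun _ h _ hl => Or.inr (Or.inl ?_)⟩
        rw [eq_one_of_drift_pos h hm (hl.trans hA.ge)]
        exact JRel_mul_left hj _
      · refine ⟨hB ▸ cyclicLen_le_of_drift_nonneg d3 hm, fun _ _ h hl => Or.inr (Or.inr ?_)⟩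
        rw [eq_one_of_drift_pos h hm (hl.trans hB.ge)]
        exact JRel_mul_left hj _
  · refine ⟨cyclicLen_le_of_drift_nonpos d1 hm, fun h _ _ hl => Or.inl ?_⟩
    rw [eq_one_of_drift_neg h hm hl]
    exact JRel_mul_left hj w

/-- From A + D = A - D = 0 and A ≥ 0 follows (aa) = 0, and likewise (bb) = 0. Below length two the
counts vanish by convention. -/
theorem exists_isAlternating_conj {u : F2}
    (h : ∀ s ∈ elementaryMoves, cyclicLen (s u) = cyclicLen u) :
    ∃ g : F2, IsAlternating (g * u * g⁻¹) ∧ len (g * u * g⁻¹) = cyclicLen u := by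
  obtain ⟨g, hg, hl⟩ := exists_conj_mem_C2 u
  refine ⟨g, ⟨hg, ?_⟩, hl⟩
  rcases lt_or_ge (len (g * u * g⁻¹)) 2 with h2 | h2
  · exact ⟨subwordCount_of_len_lt h2, subwordCount_of_len_lt h2⟩
  · have h1 : ∀ s ∈ elementaryMoves, cyclicLen (s (g * u * g⁻¹)) = len (g * u * g⁻¹) :=
      fun s hs => by rw [cyclicLen_map_conj, h s hs, hl]
    rw [subwordCount_eq_cyclicCount toWord_aa h2, subwordCount_eq_cyclicCount toWord_bb h2]
    have e1 := cyclicLen_posA_eq hg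
    have e2 := cyclicLen_posA_inv_eq hg
    have e3 := cyclicLen_posB_eq hg
    have e4 := cyclicLen_posB_inv_eq hg
    rw [h1 _ (by simp [elementaryMoves])] at e1 e2 e3 e4
    constructor <;> omega

theorem isMinimal_of_len_le_one {w : F2} (h : len w ≤ 1) : IsMinimal w := fun φ => by
  by_contra! hlt
  have h1 : len (φ w) = 0 := by omega
  rw [len_eq_zero, map_eq_one_iff φ φ.injective, ← len_eq_zero] at h1
  omega

theorem posA_negB (w : F2) : posA (negB w) = negB (posA⁻¹ w) := by
  have : posA * negB = negB * posA⁻¹ := by apply aut_ext <;> simp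
  exact DFunLike.congr_fun this w

theorem posB_negB (w : F2) : posB (negB w) = negB (MulAut.conj a⁻¹ (posB⁻¹ w)) := by
  have : posB * negB = negB * (MulAut.conj a⁻¹ * posB⁻¹) := by
    apply aut_ext <;> simp [mul_assoc]
  exact DFunLike.congr_fun this w

/-- A nonalternating root word has, up to inverting a letter, two moves of the same triangle which
preserve the length. -/
theorem IsRootWord.exists_triangle {w : F2} (h : IsRootWord w) (h2 : 2 ≤ len w) :
    ∃ π : MulAut F2, cyclicLen (posA (π w)) = cyclicLen (π w) ∧
      cyclicLen (posB (π w)) = cyclicLen (π w) := by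
  obtain ⟨hw, hab, haa⟩ := h
  rw [subwordCount_eq_cyclicCount toWord_ab h2, subwordCount_eq_cyclicCount toWord_ab_inv h2,
    subwordCount_eq_cyclicCount toWord_aa h2] at hab
  rw [subwordCount_eq_cyclicCount toWord_aa h2, subwordCount_eq_cyclicCount toWord_bb h2] at haa
  have e0 := cyclicLen_of_mem_C2 hw
  have e1 := cyclicLen_posA_eq hw
  have e2 := cyclicLen_posA_inv_eq hw
  have e3 := cyclicLen_posB_eq hw
  have e4 := cyclicLen_posB_inv_eq hw
  rcases abs_cases ((cyclicCount (0, true) (1, true) w : ℤ) - cyclicCount (0, true) (1, false) w)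
    with h | h
  -- Here D = A = B, so the negative moves preserve the length; inverting b turns them into positive
  -- ones, up to conjugation.
  · refine ⟨negB, ?_⟩
    rw [posA_negB, posB_negB, isPermutation_negB.cyclicLen_eq, isPermutation_negB.cyclicLen_eq,
      isPermutation_negB.cyclicLen_eq, cyclicLen_of_mem_J (conj_mem_J _)]
    constructor <;> omega
  · refine ⟨1, ?_⟩
    simp only [MulAut.one_apply]
    constructor <;> omega

/-! ### Counting edges, and quotients of the bidirected 3-cycle -/

/-- The exponent sum of `b`. -/
def exponentB : F2 →* Multiplicative ℤ := FreeGroup.lift ![1, Multiplicative.ofAdd 1]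

theorem coe_ne_of_exponentB_ne {φ ψ : MulAut F2} (h : exponentB (φ a) ≠ exponentB (ψ a)) :
    (φ : MulAut F2 ⧸ Inn) ≠ ψ := fun e => by
  obtain ⟨g, rfl⟩ := exists_conj_mul_of_coe_eq e
  apply h
  simp [mul_comm]

theorem coe_posA_ne_coe_posB : (posA : MulAut F2 ⧸ Inn) ≠ posB :=
  coe_ne_of_exponentB_ne (by rw [posA_a, posB_a]; simp [exponentB, a, b])

theorem coe_posA_inv_ne_coe_posB_inv :
    ((posA⁻¹ : MulAut F2) : MulAut F2 ⧸ Inn) ≠ (posB⁻¹ : MulAut F2) :=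
  coe_ne_of_exponentB_ne (by rw [posA_inv_a, posB_inv_a]; simp [exponentB, a, b])

open Classical in
-- Distinctness of the two classes matters: when both moves lead to `v`, they give two parallel
-- edges.
theorem ncard_connecting {w v : F2} {s t : MulAut F2} (hs : s ∈ elementaryMoves)
    (ht : t ∈ elementaryMoves) (hst : (s : MulAut F2 ⧸ Inn) ≠ t)
    (h : ∀ r ∈ elementaryMoves, r = s ∨ r = t ∨ ¬ JRel (r w) v) :
    (connecting w v).ncard = (if JRel (s w) v then 1 else 0) + (if JRel (t w) v then 1 else 0) := by
  have e : connecting w v = (if JRel (s w) v then {(s : MulAut F2 ⧸ Inn)} else ∅) ∪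
      (if JRel (t w) v then {(t : MulAut F2 ⧸ Inn)} else ∅) := by
    ext c
    constructor
    · rintro ⟨φ, hφ, rfl, hv⟩
      obtain ⟨r, hr, g, rfl⟩ := hφ.exists_move
      have hv' : JRel (r w) v := (JRel_mul_left (conj_mem_J g) (r w)).trans hv
      rw [coe_conj_mul]
      rcases h r hr with rfl | rfl | h'
      · exact Or.inl (by simp [hv'])
      · exact Or.inr (by simp [hv'])
      · exact absurd hv' h'
    · rintro (hc | hc)
      · split_ifs at hc with h'
        · rw [Set.mem_singleton_iff] at hc
          exact ⟨s, isOneLetter_of_mem_moves hs, hc.symm, h'⟩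
        · exact hc.elim
      · split_ifs at hc with h'
        · rw [Set.mem_singleton_iff] at hc
          exact ⟨t, isOneLetter_of_mem_moves ht, hc.symm, h'⟩
        · exact hc.elim
  rw [e]
  split_ifs <;> simp [Set.ncard_pair hst.symm]

theorem DirectedMultigraph.isomorphic_of_bijective {G : DirectedMultigraph} {n : ℕ}
    {e : Fin n → Fin n → ℕ} {f : Fin n → G.V} (hf : f.Bijective)
    (h : ∀ u v, G.edges (f u) (f v) = e u v) : G.Isomorphic ⟨Fin n, e⟩ := by
  refine ⟨(Equiv.ofBijective f hf).symm, fun u v => ?_⟩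
  obtain ⟨u, rfl⟩ := hf.2 u
  obtain ⟨v, rfl⟩ := hf.2 v
  rw [h, Equiv.ofBijective_symm_apply_apply, Equiv.ofBijective_symm_apply_apply]

open Classical in
/-- A directed multigraph which is a quotient of the bidirected 3-cycle, in the sense that the
edges are counted at any preimage of their source, is one of three. -/
theorem DirectedMultigraph.isomorphic_of_triangle {G : DirectedMultigraph} (x : Fin 3 → G.V)
    (hx : x.Surjective) (h : ∀ i v, G.edges (x i) v =
      (if x (i + 1) = v then 1 else 0) + (if x (i + 2) = v then 1 else 0)) :
    G.Isomorphic R1 ∨ G.Isomorphic R2 ∨ G.Isomorphic R3 := by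
  -- Exactly two vertices coincide: the edges between them become a loop, and the third vertex sends
  -- both its edges to the merged one.
  have two : ∀ i, x (i + 1) = x (i + 2) → x i ≠ x (i + 1) → G.Isomorphic R2 := fun i h1 h2 => by
    refine isomorphic_of_bijective (f := ![x i, x (i + 1)]) ⟨?_, ?_⟩ ?_
    · intro u v huv
      fin_cases u <;> fin_cases v <;> simp_all
    · intro v
      obtain ⟨k, rfl⟩ := hx v
      have : k = i ∨ k = i + 1 ∨ k = i + 2 := by clear * -; revert k i; decide
      rcases this with rfl | rfl | rfl
      · exact ⟨0, rfl⟩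
      · exact ⟨1, rfl⟩
      · exact ⟨1, h1⟩
    · have e1 : i + 1 + 1 = i + 2 := by clear * -; revert i; decide
      have e2 : i + 1 + 2 = i := by clear * -; revert i; decide
      intro u v
      fin_cases u <;> fin_cases v <;>
        simp [h, e1, e2, ← h1, h2, h2.symm]
  by_cases h01 : x 0 = x 1
  · by_cases h12 : x 1 = x 2
    · left
      refine isomorphic_of_bijective (f := fun _ => x 0) ⟨?_, ?_⟩ ?_
      · exact fun u v _ => Subsingleton.elim u v
      · intro v
        obtain ⟨k, rfl⟩ := hx v
        fin_cases k
        · exact ⟨0, rfl⟩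
        · exact ⟨0, h01⟩
        · exact ⟨0, h01.trans h12⟩
      · intro u v
        fin_cases u
        fin_cases v
        simp [h, h01, h12]
    · exact Or.inr (Or.inl (two 2 h01 (Ne.symm (h01 ▸ h12))))
  · by_cases h12 : x 1 = x 2
    · exact Or.inr (Or.inl (two 0 h12 h01))
    · by_cases h20 : x 2 = x 0
      · exact Or.inr (Or.inl (two 1 h20 h12))
      · right; right
        refine isomorphic_of_bijective (f := x) ⟨?_, hx⟩ ?_
        · intro u v huv
          fin_cases u <;> fin_cases v <;> simp_all
        · have := Ne.symm h01
          have := Ne.symm h12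
          have := Ne.symm h20
          intro u v
          fin_cases u <;> fin_cases v <;> simp_all

end FreeGroupTwo

/-! ### The graph of a strict triangle -/

namespace FreeGroupTwo

open Classical in
/-- The graph of a class in which the minimal words form a triangle, all moves out of which increase
the length. -/
theorem Gam_isomorphic_of_triangle {W : Set F2} {w : F2} (hW : W = {v | ∃ φ : MulAut F2, φ w = v})
    (hA : cyclicLen (posA w) = cyclicLen w) (hB : cyclicLen (posB w) = cyclicLen w)
    (d0 : drift w < 0) (d1 : 0 < drift (posA w)) (d2 : 0 < drift (posB w)) :
    (Gam W).Isomorphic R1 ∨ (Gam W).Isomorphic R2 ∨ (Gam W).Isomorphic R3 := by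
  have vertex : ∀ σ : MulAut F2, cyclicLen (σ w) = cyclicLen w →
      ∃ x : MinimalWord W, JRel (σ w) x.1 := fun σ hσ => by
    obtain ⟨g, -, hg⟩ := exists_conj_mem_C2 (σ w)
    refine ⟨⟨g * σ w * g⁻¹, ?_, ?_⟩, JRel_mul_left (conj_mem_J g) _⟩
    · rw [hW]
      exact ⟨MulAut.conj g * σ, rfl⟩
    · refine isMinimal_iff.2 fun φ => ?_
      rw [hg, hσ, cyclicLen_map_conj]
      exact (triangle_minimal hA hB (φ * σ)).1
  have minimal_len : ∀ v : MinimalWord W, cyclicLen v.1 = cyclicLen w := fun v => by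
    obtain ⟨v, hv, hm⟩ := v
    rw [hW] at hv
    obtain ⟨φ, rfl⟩ := hv
    refine le_antisymm ?_ (triangle_minimal hA hB φ).1
    rw [← hm.len_eq]
    simpa using isMinimal_iff.1 hm φ⁻¹
  have longer : ∀ {u : F2} (v : MinimalWord W), cyclicLen w < cyclicLen u → ¬ JRel u v.1 :=
    fun v h hr => by
      have := cyclicLen_eq_of_JRel hr
      rw [minimal_len v] at this
      omega
  have m1 : posA ∈ elementaryMoves := by simp [elementaryMoves]
  have m2 : posA⁻¹ ∈ elementaryMoves := by simp [elementaryMoves]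
  have m3 : posB ∈ elementaryMoves := by simp [elementaryMoves]
  have m4 : posB⁻¹ ∈ elementaryMoves := by simp [elementaryMoves]
  obtain ⟨x0, h0⟩ := vertex 1 rfl
  obtain ⟨x1, h1⟩ := vertex posA hA
  obtain ⟨x2, h2⟩ := vertex posB hB
  have h0 : JRel w x0.1 := h0
  let q : MinimalWord W → (Gam W).V := Quotient.mk (minimalSetoid W)
  have hq : ∀ x v, q x = q v ↔ JRel x.1 v.1 := fun x v =>
    ⟨fun h => Quotient.exact h, fun h => Quotient.sound h⟩
  have hedge : ∀ {u : F2} {x x' x'' : MinimalWord W} {s t : MulAut F2} (v : MinimalWord W),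
      JRel u x.1 → JRel (s u) x'.1 → JRel (t u) x''.1 → s ∈ elementaryMoves →
      t ∈ elementaryMoves → (s : MulAut F2 ⧸ Inn) ≠ t →
      (∀ r ∈ elementaryMoves, r = s ∨ r = t ∨ cyclicLen w < cyclicLen (r u)) →
      (Gam W).edges (q x) (q v) = (if q x' = q v then 1 else 0) +
        (if q x'' = q v then 1 else 0) := by
    intro u x x' x'' s t v hx hx' hx'' hs ht hst hr
    have e1 : JRel (s u) v.1 ↔ q x' = q v := by
      rw [hq]
      exact ⟨hx'.symm.trans, hx'.trans⟩
    have e2 : JRel (t u) v.1 ↔ q x'' = q v := by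
      rw [hq]
      exact ⟨hx''.symm.trans, hx''.trans⟩
    change (connecting x.1 v.1).ncard = _
    rw [← ncard_connecting_congr hx (JRel.refl v.1), ncard_connecting hs ht hst fun r hm =>
      (hr r hm).imp_right (Or.imp_right (longer v))]
    simp only [e1, e2]
  -- The third side of the triangle, traversed in one direction here and in the other in `jB`.
  have jA : JRel (posB⁻¹ (posA w)) x2.1 := by
    obtain ⟨j, hj, e⟩ := exists_posB_inv_mul_posA
    have e' : posB⁻¹ (posA w) = j (posB w) := DFunLike.congr_fun e w
    rw [e']
    exact (JRel_mul_left hj _).symm.trans h2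
  have jB : JRel (posA⁻¹ (posB w)) x1.1 := by
    obtain ⟨j, hj, e⟩ := exists_posA_inv_mul_posB
    have e' : posA⁻¹ (posB w) = j (posA w) := DFunLike.congr_fun e w
    rw [e']
    exact (JRel_mul_left hj _).symm.trans h1
  have jA' : JRel (posA⁻¹ (posA w)) x0.1 := by rwa [posA_inv_posA]
  have jB' : JRel (posB⁻¹ (posB w)) x0.1 := by rwa [posB_inv_posB]
  refine DirectedMultigraph.isomorphic_of_triangle ![q x0, q x1, q x2] ?_ ?_
  · intro v
    obtain ⟨v, rfl⟩ := Quotient.exists_rep v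
    obtain ⟨φ, hφ⟩ := (Set.ext_iff.1 hW v.1).1 v.2.1
    have hl := minimal_len v
    rw [← hφ] at hl
    rcases (triangle_minimal hA hB φ).2 d0 d1 d2 hl.le with h | h | h <;> rw [hφ] at h
    · exact ⟨0, (hq _ _).2 (h0.symm.trans h)⟩
    · exact ⟨1, (hq _ _).2 (h1.symm.trans h)⟩
    · exact ⟨2, (hq _ _).2 (h2.symm.trans h)⟩
  -- At `w` the negative drift makes the negative moves lengthen the word; at the other two vertices
  -- positive drift does so for the positive moves. The two moves left over lead to the other
  -- vertices.
  · intro i v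
    obtain ⟨v, rfl⟩ := Quotient.exists_rep v
    fin_cases i
    · refine hedge v h0 h1 h2 m1 m3 coe_posA_ne_coe_posB ?_
      rintro r (rfl | rfl | rfl | rfl)
      · exact Or.inl rfl
      · exact Or.inr (Or.inr ((drift_neg_step (Or.inl rfl)).2 d0).1)
      · exact Or.inr (Or.inl rfl)
      · exact Or.inr (Or.inr ((drift_neg_step (Or.inr rfl)).2 d0).1)
    · refine (hedge v h1 jA' jA m2 m4 coe_posA_inv_ne_coe_posB_inv ?_).trans (add_comm _ _)
      rintro r (rfl | rfl | rfl | rfl)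
      · exact Or.inr (Or.inr (hA ▸ ((drift_pos_step (Or.inl rfl)).2 d1).1))
      · exact Or.inl rfl
      · exact Or.inr (Or.inr (hA ▸ ((drift_pos_step (Or.inr rfl)).2 d1).1))
      · exact Or.inr (Or.inl rfl)
    · refine (hedge v h2 jB jB' m2 m4 coe_posA_inv_ne_coe_posB_inv ?_).trans (add_comm _ _)
      rintro r (rfl | rfl | rfl | rfl)
      · exact Or.inr (Or.inr (hB ▸ ((drift_pos_step (Or.inl rfl)).2 d2).1))
      · exact Or.inl rfl
      · exact Or.inr (Or.inr (hB ▸ ((drift_pos_step (Or.inr rfl)).2 d2).1))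
      · exact Or.inr (Or.inl rfl)

/-- At a vertex of a triangle of minimal words where the drift vanishes, every move preserves the
length. -/
theorem cyclicLen_move_eq_of_drift_eq_zero {w : F2} (hA : cyclicLen (posA w) = cyclicLen w)
    (hB : cyclicLen (posB w) = cyclicLen w) :
    (drift w = 0 → ∀ s ∈ elementaryMoves, cyclicLen (s w) = cyclicLen w) ∧
    (drift (posA w) = 0 → ∀ s ∈ elementaryMoves, cyclicLen (s (posA w)) = cyclicLen (posA w)) ∧
    (drift (posB w) = 0 → ∀ s ∈ elementaryMoves, cyclicLen (s (posB w)) = cyclicLen (posB w)) := by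
  have jA : cyclicLen (posB⁻¹ (posA w)) = cyclicLen w := by
    obtain ⟨j, hj, e⟩ := exists_posB_inv_mul_posA
    have e' : posB⁻¹ (posA w) = j (posB w) := DFunLike.congr_fun e w
    rw [e', cyclicLen_of_mem_J hj, hB]
  have jB : cyclicLen (posA⁻¹ (posB w)) = cyclicLen w := by
    obtain ⟨j, hj, e⟩ := exists_posA_inv_mul_posB
    have e' : posA⁻¹ (posB w) = j (posA w) := DFunLike.congr_fun e w
    rw [e', cyclicLen_of_mem_J hj, hA]
  have jA' := posA_inv_posA w
  have jB' := posB_inv_posB w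
  refine ⟨?_, ?_, ?_⟩
  · obtain ⟨A, B, D, h1, h2, h3, h4⟩ := exists_increments w
    unfold drift
    rintro hd s (rfl | rfl | rfl | rfl) <;> omega
  · obtain ⟨A, B, D, h1, h2, h3, h4⟩ := exists_increments (posA w)
    unfold drift
    rw [jA'] at h2 ⊢
    rintro hd s (rfl | rfl | rfl | rfl) <;> try rw [jA']
    all_goals omega
  · obtain ⟨A, B, D, h1, h2, h3, h4⟩ := exists_increments (posB w)
    unfold drift
    rw [jB'] at h4
    rintro hd s (rfl | rfl | rfl | rfl) <;> try rw [jB']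
    all_goals omega

end FreeGroupTwo

theorem theorem3 (W : Set FreeGroupTwo.F2) (hW : FreeGroupTwo.IsRootClass W)
    (hna : ¬ ∃ w ∈ W, FreeGroupTwo.IsMinimal w ∧ FreeGroupTwo.IsAlternating w) :
    (FreeGroupTwo.Gam W).Isomorphic FreeGroupTwo.R1 ∨
      (FreeGroupTwo.Gam W).Isomorphic FreeGroupTwo.R2 ∨
      (FreeGroupTwo.Gam W).Isomorphic FreeGroupTwo.R3 := by
  open FreeGroupTwo in
  obtain ⟨⟨w₀, rfl⟩, w₁, ⟨ρ, rfl⟩, hroot⟩ := hW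
  -- A shorter root word would be minimal, and alternating because all its pair counts are 0 by
  -- convention.
  have h2 : 2 ≤ len (ρ w₀) := by
    by_contra! hlt
    refine hna ⟨ρ w₀, ⟨ρ, rfl⟩, isMinimal_of_len_le_one (by omega), hroot.1, ?_, ?_⟩ <;>
      exact subwordCount_of_len_lt hlt
  obtain ⟨π, hA, hB⟩ := hroot.exists_triangle h2
  set w := π (ρ w₀) with hw
  have horbit : {v | ∃ φ : MulAut F2, φ w₀ = v} = {v | ∃ φ : MulAut F2, φ w = v} := by
    ext v
    constructor
    · rintro ⟨φ, rfl⟩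
      exact ⟨φ * (π * ρ)⁻¹, by simp [hw]⟩
    · rintro ⟨φ, rfl⟩
      exact ⟨φ * (π * ρ), rfl⟩
  -- If all moves preserved the length at such a word, a conjugate of it would be an alternating
  -- minimal word; this excludes zero drift at each vertex.
  have not_all : ∀ σ : MulAut F2, cyclicLen (σ w) = cyclicLen w →
      ¬ ∀ s ∈ elementaryMoves, cyclicLen (s (σ w)) = cyclicLen (σ w) := fun σ hσ hs => by
    obtain ⟨g, halt, hl⟩ := exists_isAlternating_conj hs
    refine hna ⟨g * σ w * g⁻¹, ?_, ?_, halt⟩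
    · rw [horbit]
      exact ⟨MulAut.conj g * σ, rfl⟩
    · refine isMinimal_iff.2 fun φ => ?_
      rw [hl, hσ, cyclicLen_map_conj]
      exact (triangle_minimal hA hB (φ * σ)).1
  obtain ⟨d0, d1, d2⟩ := drift_signs_of_triangle hA hB
  obtain ⟨c0, c1, c2⟩ := cyclicLen_move_eq_of_drift_eq_zero hA hB
  exact Gam_isomorphic_of_triangle horbit hA hB
    (lt_of_le_of_ne d0 fun h => not_all 1 rfl (c0 h))
    (lt_of_le_of_ne d1 fun h => not_all posA hA (c1 h.symm))
    (lt_of_le_of_ne d2 fun h => not_all posB hB (c2 h.symm))
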